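/- **Theorem (Restricted sum relations).** Let $\mathcal A=\prod_p(\mathbb Z/p\mathbb Z)\big/\bigoplus_p(\mathbb Z/p\mathbb Z)$, where $p$ runs over all primes; it is a $\mathbb Q$-algebra. For a tuple $\mathbf s=(s_1,\dots,s_d)$ of nonzero integers let $$M_{\mathcal A}(\mathbf s)=\Big(\sum_{p>n_1>\cdots>n_d>0}\ \prod_{j=1}^d\frac{1}{n_j^{|s_j|}}\bmod p\Big)_p,\qquad M^\star_{\mathcal A}(\mathbf s)=\Big(\sum_{p>n_1\ge\cdots\ge n_d>0}\ \prod_{j=1}^d\frac{1}{n_j^{|s_j|}}\bmod p\Big)_p\in\mathcal A,$$ where both sums are restricted to those $n_j$ that are even if $s_j>0$ and odd if $s_j<0$. Its weight is $|\mathbf s|=|s_1|+\cdots+|s_d|$ and its depth is $d$. For $w\ge 2$ let $\beta_w=\big(B_{p-w}/w \bmod p\big)_{p>w}\in\mathcal A$, where $\frac{t}{e^t-1}=\sum_{n\ge0}B_n\frac{t^n}{n!}$. Let $1\le d\le w$. Let $I_{w,d}$ be the set of all $\mathbf s\in(\mathbb Z\setminus\{0\})^d$ of weight $w$, and put $$I_{w,d,i}=\{\mathbf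 s\in I_{w,d}:|s_i|\ge2\}\ (1\le i\le d),\qquad I_{w,d,i,i}=\{\mathbf s\in I_{w,d}:|s_i|\ge3\}\ (1\le i\le d),$$ $$I_{w,d,i,j}=\{\mathbf s\in I_{w,d}:|s_i|\ge2,\ |s_j|\ge2\}\ (1\le j<i\le d).$$ Then: 1. $\displaystyle\sum_{\mathbf s\in I_{w,d}}M_{\mathcal A}(\mathbf s)=\sum_{\mathbf s\in I_{w,d}}M^\star_{\mathcal A}(\mathbf s)=0$. 2. For $1\le i\le d$, $$\sum_{\mathbf s\in I_{w,d,i}}M_{\mathcal A}(\mathbf s)=(-1)^{i-1}\Big(\binom{w-1}{i-1}+(-1)^d\binom{w-1}{d-i}\Big)\beta_w,$$ $$\sum_{\mathbf s\in I_{w,d,i}}M^\star_{\mathcal A}(\mathbf s)=(-1)^{i-1}\Big((-1)^d\binom{w-1}{i-1}+\binom{w-1}{d-i}\Big)\beta_w.$$ 3. If $w$ is odd, then for $1\le j\le i\le d$, $$\sum_{\mathbf s\in I_{w,d,i,j}}M_{\mathcal A}(\mathbf s)=(-1)^d\sum_{\mathbf s\in I_{w,d,i,j}}M^\star_{\mathcal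 A}(\mathbf s)=\tfrac12N_{w,d,i,j}\,\beta_w,$$ where $N_{w,d,i,j}$ is the integer $g(j)-g(d+1-i)$ with, for $1\le m\le d$, $$g(m)=(-1)^m\Big(\binom{w-2}{m-1}+(w-d-1)\binom{w-1}{m-1}-(-1)^d\binom{w-2}{d-m}\Big).$$ (For $w=1$ all coefficients of $\beta_w$ are $0$, with $N_{1,1,1,1}=0$, and the right-hand sides in 2 and 3 are read as $0$.) -/

import Mathlib

namespace FiniteMMV

/-- The direct sum of the `ℤ/pℤ` over all primes `p`, as an ideal of their product: the families
with only finitely many nonzero components. -/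
def finSuppIdeal : Ideal ((p : {p : ℕ // p.Prime}) → ZMod (p : ℕ)) where
  carrier := {f | {p | f p ≠ 0}.Finite}
  zero_mem' := by simp
  add_mem' := by
    intro f g hf hg
    refine (Set.Finite.union hf hg).subset fun p hp => ?_
    by_contra h
    simp only [Set.mem_union, Set.mem_ofPred_eq, not_or, not_not] at h
    exact hp (by simp [h.1, h.2])
  smul_mem' := by
    intro c f hf
    refine Set.Finite.subset hf fun p hp h => ?_
    exact hp (by simp [h])

/-- The ring `𝒜 = (∏ₚ ℤ/pℤ) / (⨁ₚ ℤ/pℤ)`. -/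
def PrimeAdele : Type := ((p : {p : ℕ // p.Prime}) → ZMod (p : ℕ)) ⧸ finSuppIdeal

noncomputable instance : CommRing PrimeAdele :=
  inferInstanceAs (CommRing (((p : {p : ℕ // p.Prime}) → ZMod (p : ℕ)) ⧸ finSuppIdeal))

/-- The class in `𝒜` of a family of residues. -/
noncomputable def PrimeAdele.mk : ((p : {p : ℕ // p.Prime}) → ZMod (p : ℕ)) →+* PrimeAdele :=
  Ideal.Quotient.mk finSuppIdeal

/-- Two families have the same class iff they agree at all but finitely many primes. -/
theorem PrimeAdele.mk_eq_mk {f g : (p : {p : ℕ // p.Prime}) → ZMod (p : ℕ)} :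
    PrimeAdele.mk f = PrimeAdele.mk g ↔ {p | f p ≠ g p}.Finite := by
  have h : {p | f p ≠ g p} = {p | (f - g) p ≠ 0} := by
    ext p
    simp [sub_ne_zero]
  rw [h]
  exact Ideal.Quotient.eq

instance factPrime (p : {p : ℕ // p.Prime}) : Fact (p : ℕ).Prime := ⟨p.2⟩

/-- A nonzero natural number is nonzero modulo all but finitely many primes. -/
theorem finite_cast_eq_zero {n : ℕ} (hn : n ≠ 0) :
    {p : {p : ℕ // p.Prime} | (n : ZMod (p : ℕ)) = 0}.Finite := by
  refine Set.Finite.of_finite_image (f := fun p : {p : ℕ // p.Prime} => (p : ℕ))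
    ((Set.finite_le_nat n).subset ?_) (fun a _ b _ h => Subtype.ext h)
  rintro _ ⟨p, hp, rfl⟩
  exact Nat.le_of_dvd (Nat.pos_of_ne_zero hn) ((ZMod.natCast_eq_zero_iff n p).1 hp)

/-- The embedding of `ℚ` in `𝒜`: reduce a rational number modulo every prime that does not divide
its denominator. -/
noncomputable def ratHom : ℚ →+* PrimeAdele where
  toFun q := PrimeAdele.mk fun p => (q : ZMod (p : ℕ))
  map_one' := by
    rw [← map_one PrimeAdele.mk]
    congr 1
    funext p
    simp
  map_zero' := by
    rw [← map_zero PrimeAdele.mk]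
    congr 1
    funext p
    simp
  map_mul' a b := by
    have h : PrimeAdele.mk (fun p => ((a * b : ℚ) : ZMod (p : ℕ))) =
        PrimeAdele.mk (fun p => (a : ZMod (p : ℕ)) * (b : ZMod (p : ℕ))) := by
      refine PrimeAdele.mk_eq_mk.2 (((finite_cast_eq_zero a.den_ne_zero).union
        (finite_cast_eq_zero b.den_ne_zero)).subset fun p hp => ?_)
      by_contra hc
      simp only [Set.mem_union, Set.mem_ofPred_eq, not_or] at hc
      exact hp (Rat.cast_mul_of_ne_zero hc.1 hc.2)
    rw [h]
    exact map_mul PrimeAdele.mk (fun p : {p : ℕ // p.Prime} => (a : ZMod (p : ℕ)))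
      (fun p : {p : ℕ // p.Prime} => (b : ZMod (p : ℕ)))
  map_add' a b := by
    have h : PrimeAdele.mk (fun p => ((a + b : ℚ) : ZMod (p : ℕ))) =
        PrimeAdele.mk (fun p => (a : ZMod (p : ℕ)) + (b : ZMod (p : ℕ))) := by
      refine PrimeAdele.mk_eq_mk.2 (((finite_cast_eq_zero a.den_ne_zero).union
        (finite_cast_eq_zero b.den_ne_zero)).subset fun p hp => ?_)
      by_contra hc
      simp only [Set.mem_union, Set.mem_ofPred_eq, not_or] at hc
      exact hp (Rat.cast_add_of_ne_zero hc.1 hc.2)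
    rw [h]
    exact map_add PrimeAdele.mk (fun p : {p : ℕ // p.Prime} => (a : ZMod (p : ℕ)))
      (fun p : {p : ℕ // p.Prime} => (b : ZMod (p : ℕ)))

/-- `𝒜` is a `ℚ`-algebra. -/
noncomputable instance : Algebra ℚ PrimeAdele := ratHom.toAlgebra

/-- The Bernoulli element `β_w = (B_{p-w} / w)_{p > w}` of `𝒜`, the finite analog of `ζ(w)`; the
components at the finitely many primes `p ≤ w` are irrelevant. It is meant for `w ≥ 2`. -/
noncomputable def beta (w : ℕ) : PrimeAdele :=
  PrimeAdele.mk fun p =>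
    if w < (p : ℕ) then ((bernoulli ((p : ℕ) - w) / (w : ℚ) : ℚ) : ZMod (p : ℕ)) else 0

/-- The summation range of the partial sums `M_N(s)`: all `n = (n_1, …, n_d)` with
`N > n_1 > ⋯ > n_d > 0`, where `n_j` is even if `s_j > 0` and odd if `s_j < 0`. -/
def range (N : ℕ) {d : ℕ} (s : Fin d → ℤ) : Finset (Fin d → ℕ) :=
  {n ∈ Fintype.piFinset fun _ => Finset.Ioo 0 N | StrictAnti n ∧ ∀ j, (0 < s j ↔ Even (n j))}

/-- The summation range of the star sums: as `range`, with `N > n_1 ≥ ⋯ ≥ n_d > 0`. -/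
def rangeStar (N : ℕ) {d : ℕ} (s : Fin d → ℤ) : Finset (Fin d → ℕ) :=
  {n ∈ Fintype.piFinset fun _ => Finset.Ioo 0 N | Antitone n ∧ ∀ j, (0 < s j ↔ Even (n j))}

/-- The finite multiple mixed value `M_𝒜(s)`. Its component at `p` is the residue modulo `p` of
`M_p(s) = ∑ ∏_j 1 / n_j ^ |s_j|`; all `n_j` lie in `{1, …, p - 1}`, so the sum can be formed
in `ℤ/pℤ`. -/
noncomputable def M {d : ℕ} (s : Fin d → ℤ) : PrimeAdele :=
  PrimeAdele.mk fun p =>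
    ∑ n ∈ range (p : ℕ) s, ∏ j, ((n j : ZMod (p : ℕ)) ^ (s j).natAbs)⁻¹

/-- The finite multiple mixed star value `M^⋆_𝒜(s)`. -/
noncomputable def MStar {d : ℕ} (s : Fin d → ℤ) : PrimeAdele :=
  PrimeAdele.mk fun p =>
    ∑ n ∈ rangeStar (p : ℕ) s, ∏ j, ((n j : ZMod (p : ℕ)) ^ (s j).natAbs)⁻¹

/-- `I_{w,d}`: the `s = (s_1, …, s_d)` of nonzero integers with `|s_1| + ⋯ + |s_d| = w`. (The box
`[-w, w]^d` contains all of them and only makes the set a `Finset`.) -/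
noncomputable def indices (w d : ℕ) : Finset (Fin d → ℤ) :=
  {s ∈ Fintype.piFinset fun _ => Finset.Icc (-(w : ℤ)) w |
    (∀ j, s j ≠ 0) ∧ ∑ j, (s j).natAbs = w}

/-- `I_{w,d,i}`: those with `|s_i| ≥ 2`. -/
noncomputable def indices₁ (w : ℕ) {d : ℕ} (i : Fin d) : Finset (Fin d → ℤ) :=
  {s ∈ indices w d | 2 ≤ (s i).natAbs}

/-- `I_{w,d,i,j}`: those with `|s_i| ≥ 2` and `|s_j| ≥ 2` if `i ≠ j`, and those with `|s_i| ≥ 3`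
if `i = j`. -/
noncomputable def indices₂ (w : ℕ) {d : ℕ} (i j : Fin d) : Finset (Fin d → ℤ) :=
  {s ∈ indices w d |
    if i = j then 3 ≤ (s i).natAbs else 2 ≤ (s i).natAbs ∧ 2 ≤ (s j).natAbs}

/-- The integer
`g_{w,d}(m) = (-1)^m (C(w-2,m-1) + (w-d-1) C(w-1,m-1) - (-1)^d C(w-2,d-m))` for `1 ≤ m ≤ d ≤ w`. -/
def coeffAux (w d m : ℕ) : ℤ :=
  (-1) ^ m * ((w - 2).choose (m - 1) + ((w : ℤ) - d - 1) * (w - 1).choose (m - 1)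
    - (-1) ^ d * (w - 2).choose (d - m))

/-- `N_{w,d,i,j} = g_{w,d}(j) - g_{w,d}(d + 1 - i)` for (one-based) positions `1 ≤ j ≤ i ≤ d` and
odd weight `w`. -/
def coeffN (w d i j : ℕ) : ℤ := coeffAux w d j - coeffAux w d (d + 1 - i)

end FiniteMMV

/-! Summing over all signs removes the parity conditions, since each tuple (n_j) fits exactly one
sign pattern. Summing over all exponents of total weight w then gives, modulo p, the coefficient of
X^w in a chain sum with entries y^e/(1 - y), y = X/n_j, where e is the lower bound imposed on |s_j|
(`sum_indices_eq_coeff`). Multiplication by ∏_{0<m<p} (1 - X/m) = 1 - X^(p-1) changes no coefficient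
of degree below p - 1 and clears all denominators. The chain sum becomes a signed binomial
combination of power chains whose exponents are 1 except at the marked positions, those with e > 1
(`expand_replicate`, `expand_append_cons`).

Power chains with all exponents 1 are elementary symmetric functions of the 1/m and vanish modulo p
unless the length is 0 or p - 1; this gives statement 1. A larger exponent is lowered by the
hockey-stick identity ∑_{l≤N} ∏_{m<n} (1 - l/m) = (N/n) ∏_{m<n} (1 - N/m): division by n acts on
these symmetric functions through the coefficients of Faulhaber's polynomials
(`sum_faulhaberMod_mul_powChain`). One application evaluates a chain with a single 2 as a binomial
multiple of β_w (`powChain_two`). A 3 or two 2's need a second one and give a sum of products of two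
Bernoulli numbers; for odd w parity leaves only the terms containing B_1
(`sum_faulhaberMod_mul_powChain_two`). The remaining binomial sums are evaluated because a w-th
finite difference kills polynomials of degree below w.

Star sums follow from the antipode relation `altSum_nil_left`. Modulo X^(p-1) the unmarked chain
sums vanish, so with one marked entry the antipode just reverses the chain up to sign. With two
marked entries products of two singly marked sums also occur; in odd weight one factor has even
weight and vanishes. -/

namespace FiniteMMV

open Finset

/-! ### Strict and weak chain sums and the antipode relation -/

section ChainSums

variable {R : Type*} [CommRing R]

/-- The sum of `∏ f_j(n_j)` over all `N > n_1 > ⋯ > n_d > l`. -/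
def chainSum (l : ℕ) : List (ℕ → R) → ℕ → R
  | [], _ => 1
  | f :: L, N => ∑ n ∈ Ioo l N, f n * chainSum l L n

/-- The sum of `∏ f_j(n_j)` over all `N > n_1 ≥ ⋯ ≥ n_d > 0`. -/
def chainSumStar : List (ℕ → R) → ℕ → R
  | [], _ => 1
  | f :: L, N => ∑ n ∈ Ioo 0 N, f n * chainSumStar L (n + 1)

@[simp] theorem chainSum_nil (l N : ℕ) : chainSum l ([] : List (ℕ → R)) N = 1 := rfl

theorem chainSum_cons (l N : ℕ) (f : ℕ → R) (L : List (ℕ → R)) :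
    chainSum l (f :: L) N = ∑ n ∈ Ioo l N, f n * chainSum l L n := rfl

@[simp] theorem chainSumStar_nil (N : ℕ) : chainSumStar ([] : List (ℕ → R)) N = 1 := rfl

theorem chainSumStar_cons (N : ℕ) (f : ℕ → R) (L : List (ℕ → R)) :
    chainSumStar (f :: L) N = ∑ n ∈ Ioo 0 N, f n * chainSumStar L (n + 1) := rfl

/-- Splitting a chain at one of its members. -/
theorem chainSum_append_cons (l : ℕ) (L₁ : List (ℕ → R)) (g : ℕ → R) (L₂ : List (ℕ → R)) (N : ℕ) :
    chainSum l (L₁ ++ g :: L₂) N =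
      ∑ n ∈ Ioo l N, chainSum n L₁ N * g n * chainSum l L₂ n := by
  induction L₁ generalizing N with
  | nil => simp [chainSum_cons]
  | cons f L₁ ih =>
    simp only [List.cons_append, chainSum_cons, ih, mul_sum, sum_mul]
    rw [sum_comm' (t' := Ioo l N) (s' := fun n => Ioo n N)]
    · exact sum_congr rfl fun n _ => sum_congr rfl fun m _ => by ring
    · intro m n
      simp only [mem_Ioo]
      omega

theorem Ioo_succ_eq_insert {l N : ℕ} (h : l < N) : Ioo l (N + 1) = insert N (Ioo l N) := by
  ext n
  simp only [mem_Ioo, mem_insert]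
  omega

theorem chainSum_cons_succ {l N : ℕ} (h : l < N) (f : ℕ → R) (L : List (ℕ → R)) :
    chainSum l (f :: L) (N + 1) = chainSum l (f :: L) N + f N * chainSum l L N := by
  rw [chainSum_cons, chainSum_cons, Ioo_succ_eq_insert h, sum_insert (by simp), add_comm]

theorem chainSum_replicate_eq_zero {l N r : ℕ} (f : ℕ → R) (h : N < l + 1 + r) (hr : r ≠ 0) :
    chainSum l (List.replicate r f) N = 0 := by
  induction r generalizing N with
  | zero => exact absurd rfl hr
  | succ r ih =>
    rw [List.replicate_succ, chainSum_cons]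
    refine sum_eq_zero fun n hn => ?_
    rw [mem_Ioo] at hn
    by_cases h0 : r = 0
    · omega
    · rw [ih (by omega) h0, mul_zero]

/-- If `f (1 - y) = y`, the chain sums of `f` are binomial combinations of those of `y`. -/
theorem prod_one_sub_mul_chainSum_replicate {f y : ℕ → R} {l K : ℕ} (r N : ℕ)
    (hf : r ≠ 0 → ∀ m, l < m → m < N → f m * (1 - y m) = y m) (hK : N ≤ l + K) :
    (∏ m ∈ Ioo l N, (1 - y m)) * chainSum l (List.replicate r f) N =
      ∑ q ∈ Finset.range (K + 1), (-1) ^ (q + r) * (q.choose r : R) *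
        chainSum l (List.replicate q y) N := by
  -- The generating function behind the identity is ∏ (1 - y + t y) = ∏ (1 - y) · ∏ (1 + t f);
  -- compare coefficients of t^r.
  induction N generalizing r with
  | zero =>
    rw [sum_eq_single_of_mem 0 (by simp)]
    · cases r <;> simp [List.replicate_succ, chainSum_cons]
    · intro q _ hq
      rw [chainSum_replicate_eq_zero _ (by omega) hq, mul_zero]
  | succ N ih =>
    rcases Nat.lt_or_ge l N with hlN | hlN
    · have ih' : ∀ s, (s ≠ 0 → r ≠ 0) → _ := fun s hs =>
        ih s (fun h m h1 h2 => hf (hs h) m h1 (by omega)) (by omega)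
      have hP : ∏ m ∈ Ioo l (N + 1), (1 - y m) = (1 - y N) * ∏ m ∈ Ioo l N, (1 - y m) := by
        rw [Ioo_succ_eq_insert hlN, prod_insert (by simp)]
      -- Allowing the new largest index `N` gives e_q(N+1) = e_q(N) + y_N e_{q-1}(N). The shifted
      -- sum may keep its top index because the chain of length `K` is zero at `N`.
      have hS : ∀ r, ∑ q ∈ Finset.range (K + 1), (-1) ^ (q + r) * (q.choose r : R) *
            chainSum l (List.replicate q y) (N + 1) =
          ∑ q ∈ Finset.range (K + 1), (-1) ^ (q + r) * (q.choose r : R) *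
            chainSum l (List.replicate q y) N +
          y N * ∑ q ∈ Finset.range (K + 1), (-1) ^ (q + 1 + r) * ((q + 1).choose r : R) *
            chainSum l (List.replicate q y) N := by
        intro r
        rw [sum_range_succ', sum_range_succ' _ K, sum_range_succ _ K,
          chainSum_replicate_eq_zero (r := K) _ (by omega) (by omega), mul_zero, add_zero,
          mul_sum]
        have : ∀ q, chainSum l (List.replicate (q + 1) y) (N + 1) =
            chainSum l (List.replicate (q + 1) y) N + y N * chainSum l (List.replicate q y) N :=
          fun q => by rw [List.replicate_succ, chainSum_cons_succ hlN]
        simp only [this, mul_add, sum_add_distrib]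
        simp only [List.replicate_zero, chainSum_nil]
        rw [add_right_comm]
        congr 1
        exact sum_congr rfl fun q _ => by ring
      rw [hP, hS]
      cases r with
      | zero =>
        have h0 := ih' 0 (by simp)
        simp only [List.replicate_zero, chainSum_nil, mul_one, Nat.choose_zero_right, add_zero,
          Nat.cast_one, pow_succ, mul_neg] at h0 ⊢
        rw [h0]
        simp only [neg_mul, sum_neg_distrib]
        ring
      | succ r =>
        have hc : ∑ q ∈ Finset.range (K + 1), (-1) ^ (q + 1 + (r + 1)) *
              ((q + 1).choose (r + 1) : R) * chainSum l (List.replicate q y) N =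
            ∑ q ∈ Finset.range (K + 1), (-1) ^ (q + r) * (q.choose r : R) *
              chainSum l (List.replicate q y) N -
            ∑ q ∈ Finset.range (K + 1), (-1) ^ (q + (r + 1)) * (q.choose (r + 1) : R) *
              chainSum l (List.replicate q y) N := by
          rw [← sum_sub_distrib]
          refine sum_congr rfl fun q _ => ?_
          rw [Nat.choose_succ_succ]
          push_cast
          ring
        rw [hc, ← ih' r (by simp), ← ih' (r + 1) (by simp), List.replicate_succ,
          chainSum_cons_succ hlN]
        linear_combination (∏ m ∈ Ioo l N, (1 - y m)) *
          chainSum l (List.replicate r f) N * hf (by simp) N hlN (by omega)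
    · have he : Ioo l (N + 1) = ∅ := by
        refine eq_empty_of_forall_notMem fun n hn => ?_
        rw [mem_Ioo] at hn
        omega
      rw [sum_eq_single_of_mem 0 (by simp)]
      · cases r <;> simp [List.replicate_succ, chainSum_cons, he]
      · intro q _ hq
        rw [chainSum_replicate_eq_zero _ (by omega) hq, mul_zero]

/-- The alternating sum of products of strict and weak chain sums, obtained by moving the members
of the second list one by one to the front of the first. -/
def altSum (N : ℕ) : List (ℕ → R) → List (ℕ → R) → R
  | A, [] => chainSum 0 A N
  | A, f :: L => chainSum 0 A N * chainSumStar (f :: L) N - altSum N (f :: A) L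

/-- The product splits according to which chain has the larger top member. A tie is counted for the
strict chain, hence the `n + 1` in the weak factor. -/
theorem chainSum_mul_chainSumStar (N : ℕ) (a f : ℕ → R) (A L : List (ℕ → R)) :
    chainSum 0 (a :: A) N * chainSumStar (f :: L) N =
      ∑ n ∈ Ioo 0 N, a n * chainSum 0 A n * chainSumStar (f :: L) (n + 1) +
      ∑ n ∈ Ioo 0 N, f n * chainSum 0 (a :: A) n * chainSumStar L (n + 1) := by
  simp only [chainSum_cons, chainSumStar_cons, mul_sum, sum_mul]
  have h : ∀ n ∈ Ioo 0 N, ∑ m ∈ Ioo 0 N, a m * chainSum 0 A m * (f n * chainSumStar L (n + 1)) =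
      ∑ m ∈ Ico n N, a m * chainSum 0 A m * (f n * chainSumStar L (n + 1)) +
      ∑ m ∈ Ioo 0 n, a m * chainSum 0 A m * (f n * chainSumStar L (n + 1)) := by
    intro n hn
    rw [mem_Ioo] at hn
    rw [← sum_union]
    · congr 1
      ext m
      simp only [mem_union, mem_Ioo, mem_Ico]
      omega
    · rw [disjoint_left]
      intro m
      simp only [mem_Ioo, mem_Ico]
      omega
  rw [sum_congr rfl h, sum_add_distrib]
  congr 1
  · rw [sum_comm' (t' := Ioo 0 N) (s' := fun m => Ioo 0 (m + 1))]
    intro n m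
    simp only [mem_Ioo, mem_Ico]
    omega
  · exact sum_congr rfl fun n _ => sum_congr rfl fun m _ => by ring

/-- Telescoping: the half of each product in which the weak chain has the larger top member is
exactly the next alternating sum, which is subtracted. -/
theorem altSum_cons_left (N : ℕ) (a : ℕ → R) (A L : List (ℕ → R)) :
    altSum N (a :: A) L = ∑ n ∈ Ioo 0 N, a n * chainSum 0 A n * chainSumStar L (n + 1) := by
  induction L generalizing a A with
  | nil => simp [altSum, chainSum_cons]
  | cons f L ih => rw [altSum, ih, chainSum_mul_chainSumStar, add_sub_cancel_right]

/-- The antipode relation between strict and weak chain sums. -/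
theorem altSum_nil_left (N : ℕ) (f : ℕ → R) (L : List (ℕ → R)) : altSum N [] (f :: L) = 0 := by
  rw [altSum, altSum_cons_left]
  simp [chainSumStar_cons]

theorem sum_piFinset_cons {d : ℕ} (N : ℕ) (P : (Fin (d + 1) → ℕ) → Prop) [DecidablePred P]
    (F : Fin (d + 1) → ℕ → R) :
    ∑ n ∈ Fintype.piFinset (fun _ : Fin (d + 1) => Ioo 0 N) with P n, ∏ j, F j (n j) =
      ∑ a ∈ Ioo 0 N, F 0 a *
        ∑ n ∈ Fintype.piFinset (fun _ : Fin d => Ioo 0 N) with P (Fin.cons a n),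
          ∏ j, F j.succ (n j) := by
  simp only [mul_sum]
  rw [sum_sigma']
  symm
  refine sum_bij' (fun x _ => Fin.cons x.1 x.2) (fun n _ => ⟨n 0, Fin.tail n⟩) ?_ ?_ ?_ ?_ ?_
  · rintro ⟨a, n⟩ h
    simp only [mem_sigma, mem_filter, Fintype.mem_piFinset] at h ⊢
    exact ⟨fun j => Fin.cases h.1 h.2.1 j, h.2.2⟩
  · intro n h
    simp only [mem_sigma, mem_filter, Fintype.mem_piFinset] at h ⊢
    exact ⟨h.1 0, fun j => h.1 j.succ, by simpa using h.2⟩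
  · rintro ⟨a, n⟩ _
    simp
  · intro n _
    simp
  · rintro ⟨a, n⟩ _
    simp [Fin.prod_univ_succ]

theorem strictAnti_cons_iff {d a : ℕ} {n : Fin d → ℕ} :
    StrictAnti (Fin.cons a n : Fin (d + 1) → ℕ) ↔ (∀ j, n j < a) ∧ StrictAnti n := by
  constructor
  · intro h
    refine ⟨fun j => by simpa using h (Fin.succ_pos j), fun i j hij => ?_⟩
    simpa using h (Fin.succ_lt_succ_iff.2 hij)
  · rintro ⟨h1, h2⟩ i j hij
    cases j using Fin.cases with
    | zero => exact absurd hij (Fin.not_lt_zero i)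
    | succ j =>
      cases i using Fin.cases with
      | zero => simpa using h1 j
      | succ i => simpa using h2 (Fin.succ_lt_succ_iff.1 hij)

theorem antitone_cons_iff {d a : ℕ} {n : Fin d → ℕ} :
    Antitone (Fin.cons a n : Fin (d + 1) → ℕ) ↔ (∀ j, n j ≤ a) ∧ Antitone n := by
  constructor
  · intro h
    refine ⟨fun j => by simpa using h (Fin.zero_le j.succ), fun i j hij => ?_⟩
    simpa using h (Fin.succ_le_succ_iff.2 hij)
  · rintro ⟨h1, h2⟩ i j hij
    cases i using Fin.cases with
    | zero =>
      cases j using Fin.cases with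
      | zero => exact le_rfl
      | succ j => simpa using h1 j
    | succ i =>
      cases j using Fin.cases with
      | zero => exact absurd hij (by simp)
      | succ j => simpa using h2 (Fin.succ_le_succ_iff.1 hij)

theorem sum_strictAnti_eq_chainSum {d : ℕ} (N : ℕ) (F : Fin d → ℕ → R) :
    ∑ n ∈ Fintype.piFinset (fun _ : Fin d => Ioo 0 N) with StrictAnti n, ∏ j, F j (n j) =
      chainSum 0 (List.ofFn F) N := by
  induction d generalizing N with
  | zero => simp [filter_true_of_mem, Subsingleton.strictAnti]
  | succ d ih =>
    rw [sum_piFinset_cons, List.ofFn_succ, chainSum_cons]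
    refine sum_congr rfl fun a ha => ?_
    rw [← ih]
    congr 2
    ext n
    simp only [mem_filter, Fintype.mem_piFinset, strictAnti_cons_iff, mem_Ioo] at ha ⊢
    constructor
    · rintro ⟨h1, h2, h3⟩
      exact ⟨fun j => ⟨(h1 j).1, h2 j⟩, h3⟩
    · rintro ⟨h1, h3⟩
      exact ⟨fun j => ⟨(h1 j).1, (h1 j).2.trans ha.2⟩, fun j => (h1 j).2, h3⟩

theorem sum_antitone_eq_chainSumStar {d : ℕ} (N : ℕ) (F : Fin d → ℕ → R) :
    ∑ n ∈ Fintype.piFinset (fun _ : Fin d => Ioo 0 N) with Antitone n, ∏ j, F j (n j) =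
      chainSumStar (List.ofFn F) N := by
  induction d generalizing N with
  | zero => simp [filter_true_of_mem, Subsingleton.antitone]
  | succ d ih =>
    rw [sum_piFinset_cons, List.ofFn_succ, chainSumStar_cons]
    refine sum_congr rfl fun a ha => ?_
    rw [← ih]
    congr 2
    ext n
    simp only [mem_filter, Fintype.mem_piFinset, antitone_cons_iff, mem_Ioo,
      Nat.lt_succ_iff] at ha ⊢
    constructor
    · rintro ⟨h1, h2, h3⟩
      exact ⟨fun j => ⟨(h1 j).1, h2 j⟩, h3⟩
    · rintro ⟨h1, h3⟩
      exact ⟨fun j => ⟨(h1 j).1, (h1 j).2.trans_lt ha.2⟩, fun j => (h1 j).2, h3⟩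

end ChainSums

/-! ### Chains of powers of a single sequence -/

section PowChain

variable {R S : Type*} [CommRing R] [CommRing S]


/-- The sum of `∏ z(n_j) ^ k_j` over all `N > n_1 > ⋯ > n_d > l`. -/
def powChain (z : ℕ → R) (l : ℕ) (ks : List ℕ) (N : ℕ) : R :=
  chainSum l (ks.map fun k m => z m ^ k) N

@[simp] theorem powChain_nil (z : ℕ → R) (l N : ℕ) : powChain z l [] N = 1 := rfl

theorem powChain_cons (z : ℕ → R) (l k : ℕ) (ks : List ℕ) (N : ℕ) :
    powChain z l (k :: ks) N = ∑ n ∈ Ioo l N, z n ^ k * powChain z l ks n := rfl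

theorem powChain_append_cons (z : ℕ → R) (l : ℕ) (ks : List ℕ) (k : ℕ) (ks' : List ℕ) (N : ℕ) :
    powChain z l (ks ++ k :: ks') N =
      ∑ n ∈ Ioo l N, powChain z n ks N * z n ^ k * powChain z l ks' n := by
  simp only [powChain, List.map_append, List.map_cons, chainSum_append_cons]

theorem powChain_replicate_one (z : ℕ → R) (l r N : ℕ) :
    powChain z l (List.replicate r 1) N = chainSum l (List.replicate r z) N := by
  simp [powChain]

theorem map_powChain (φ : R →+* S) (z : ℕ → R) (l : ℕ) (ks : List ℕ) (N : ℕ) :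
    φ (powChain z l ks N) = powChain (fun m => φ (z m)) l ks N := by
  induction ks generalizing N with
  | nil => simp
  | cons k ks ih => simp [powChain_cons, ih]

theorem powChain_congr {z z' : ℕ → R} {l N : ℕ} (h : ∀ m, l < m → m < N → z m = z' m)
    (ks : List ℕ) : powChain z l ks N = powChain z' l ks N := by
  induction ks generalizing N with
  | nil => rfl
  | cons k ks ih =>
    simp only [powChain_cons]
    refine sum_congr rfl fun n hn => ?_
    rw [mem_Ioo] at hn
    rw [h n hn.1 hn.2, ih fun m h1 h2 => h m h1 (h2.trans hn.2)]

theorem powChain_mul (c : R) (z : ℕ → R) (l : ℕ) (ks : List ℕ) (N : ℕ) :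
    powChain (fun m => c * z m) l ks N = c ^ ks.sum * powChain z l ks N := by
  induction ks generalizing N with
  | nil => simp
  | cons k ks ih =>
    simp only [powChain_cons, ih, mul_sum, List.sum_cons]
    exact sum_congr rfl fun n _ => by ring

theorem powChain_replicate_eq_zero {l N r : ℕ} (z : ℕ → R) (h : N < l + 1 + r) (hr : r ≠ 0) :
    powChain z l (List.replicate r 1) N = 0 := by
  rw [powChain_replicate_one, chainSum_replicate_eq_zero z h hr]

theorem prod_one_sub_eq_sum_powChain (c : R) (z : ℕ → R) {l N K : ℕ} (hK : N ≤ l + K) :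
    ∏ m ∈ Ioo l N, (1 - c * z m) =
      ∑ q ∈ Finset.range (K + 1), (-1) ^ q * powChain z l (List.replicate q 1) N * c ^ q := by
  -- For `r = 0` the condition on `f` is void, so `f = 0` serves.
  have h := prod_one_sub_mul_chainSum_replicate (f := 0) (y := fun m => c * z m) 0 N
    (fun h => absurd rfl h) hK
  simp only [List.replicate_zero, chainSum_nil, mul_one, add_zero, Nat.choose_zero_right,
    Nat.cast_one] at h
  rw [h]
  refine sum_congr rfl fun q _ => ?_
  rw [← powChain_replicate_one, powChain_mul]
  simp
  ring

end PowChain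

/-! ### Faulhaber's polynomials and the hockey-stick identity -/

section Faulhaber

/-- The coefficient of `X ^ (k + 1)` in the polynomial `S_v` with `S_v(n) = ∑_{1 ≤ l ≤ n} l ^ v`. -/
noncomputable def faulhaberCoeff (k v : ℕ) : ℚ :=
  bernoulli' (v - k) * (v + 1).choose (k + 1) / (v + 1)

theorem faulhaberCoeff_of_lt {k v : ℕ} (h : v < k) : faulhaberCoeff k v = 0 := by
  simp [faulhaberCoeff, Nat.choose_eq_zero_of_lt (Nat.succ_lt_succ h)]

theorem sum_Ico_pow_eq_faulhaberCoeff {v V : ℕ} (h : v < V) (n : ℕ) :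
    ∑ l ∈ Ico 1 (n + 1), (l : ℚ) ^ v =
      ∑ k ∈ Finset.range V, faulhaberCoeff k v * (n : ℚ) ^ (k + 1) := by
  rw [sum_Ico_pow, ← sum_range_reflect]
  rw [← sum_subset (range_subset_range.2 (show v + 1 ≤ V from h))]
  · refine sum_congr rfl fun k hk => ?_
    rw [mem_range] at hk
    have h1 : v + 1 - 1 - k = v - k := by omega
    have h2 : v + 1 - (v - k) = k + 1 := by omega
    rw [h1, h2, faulhaberCoeff, ← Nat.choose_symm (show k + 1 ≤ v + 1 by omega),
      show v + 1 - (k + 1) = v - k by omega]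
    ring
  · intro k _ hk
    rw [mem_range] at hk
    rw [faulhaberCoeff_of_lt (by omega), zero_mul]

/-- The product over m < n is (-1)^(n-1) C(x-1, n-1), so this is (x+1-n) C(x, n-1) = x C(x-1, n-1).
-/
theorem mul_prod_one_sub_shift (x : ℚ) (n : ℕ) (hn : 1 ≤ n) :
    (x + 1 - n) * ∏ m ∈ Ioo 0 n, (1 - (x + 1) * (m : ℚ)⁻¹) =
      x * ∏ m ∈ Ioo 0 n, (1 - x * (m : ℚ)⁻¹) := by
  induction n, hn using Nat.le_induction with
  | base =>
    have : Ioo 0 1 = ∅ := rfl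
    simp [this]
  | succ n hn ih =>
    have hn' : (n : ℚ) ≠ 0 := by positivity
    rw [Ioo_succ_eq_insert hn, prod_insert (by simp), prod_insert (by simp)]
    have h : (x + 1 - (n + 1 : ℕ)) * (1 - (x + 1) * (n : ℚ)⁻¹) =
        (1 - x * (n : ℚ)⁻¹) * (x + 1 - n) := by
      push_cast
      field_simp
      ring
    rw [← mul_assoc, h, mul_assoc, ih]
    ring

/-- Up to sign this is the hockey-stick identity ∑ C(l-1, n-1) = C(N, n) = (N/n) C(N-1, n-1). -/
theorem sum_prod_one_sub (n : ℕ) (hn : 1 ≤ n) (N : ℕ) :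
    ∑ l ∈ Ico 1 (N + 1), ∏ m ∈ Ioo 0 n, (1 - (l : ℚ) * (m : ℚ)⁻¹) =
      N * (∏ m ∈ Ioo 0 n, (1 - (N : ℚ) * (m : ℚ)⁻¹)) * (n : ℚ)⁻¹ := by
  have hn' : (n : ℚ) ≠ 0 := by positivity
  induction N with
  | zero => simp
  | succ N ih =>
    rw [sum_Ico_succ_top (by omega), ih]
    have h := mul_prod_one_sub_shift N n hn
    push_cast
    rw [← h]
    field_simp
    ring

/-- Summation of powers acts on `∏_{m < n} (1 - X / m)` as multiplication by `X / n`. -/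
theorem sum_faulhaberCoeff_mul_powChain_rat {n V : ℕ} (hn : 1 ≤ n) (hV : n ≤ V) (k : ℕ)
    (hk : k < V) :
    ∑ v ∈ Finset.range V, (-1) ^ v * faulhaberCoeff k v *
        powChain (fun m => (m : ℚ)⁻¹) 0 (List.replicate v 1) n =
      (-1) ^ k * ((n : ℚ)⁻¹ * powChain (fun m => (m : ℚ)⁻¹) 0 (List.replicate k 1) n) := by
  set e : ℕ → ℚ := fun v => powChain (fun m => (m : ℚ)⁻¹) 0 (List.replicate v 1) n with he
  obtain ⟨V, rfl⟩ : ∃ U, V = U + 1 := ⟨V - 1, by omega⟩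
  have hprod : ∀ x : ℚ, ∏ m ∈ Ioo 0 n, (1 - x * (m : ℚ)⁻¹) =
      ∑ q ∈ Finset.range (V + 1), (-1) ^ q * e q * x ^ q := by
    intro x
    rw [prod_one_sub_eq_sum_powChain (K := V + 1) x _ (by omega), sum_range_succ,
      powChain_replicate_eq_zero _ (by omega) (by omega)]
    simp [he]
  let P : Polynomial ℚ := ∑ k ∈ Finset.range (V + 1), Polynomial.monomial (k + 1)
    (∑ v ∈ Finset.range (V + 1), (-1) ^ v * faulhaberCoeff k v * e v)
  let Q : Polynomial ℚ := ∑ k ∈ Finset.range (V + 1), Polynomial.monomial (k + 1)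
    ((-1) ^ k * ((n : ℚ)⁻¹ * e k))
  -- At each natural number N both polynomials give ∑_{l≤N} ∏_{m<n} (1 - l/m): `P` through sums of
  -- powers, `Q` through `sum_prod_one_sub`. Infinitely many common values force equality.
  have hPQ : P = Q := by
    refine Polynomial.eq_of_infinite_eval_eq P Q
      ((Set.infinite_range_of_injective (Nat.cast_injective (R := ℚ))).mono ?_)
    rintro _ ⟨N, rfl⟩
    have h := sum_prod_one_sub n hn N
    simp only [hprod] at h
    rw [sum_comm] at h
    simp only [← mul_sum] at h
    simp only [Set.mem_ofPred_eq, P, Q, Polynomial.eval_finsetSum, Polynomial.eval_monomial]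
    calc _ = ∑ v ∈ Finset.range (V + 1), (-1) ^ v * e v * ∑ l ∈ Ico 1 (N + 1), (l : ℚ) ^ v := by
          simp only [sum_mul]
          rw [sum_comm]
          refine sum_congr rfl fun v hv => ?_
          rw [sum_Ico_pow_eq_faulhaberCoeff (mem_range.1 hv), mul_sum]
          exact sum_congr rfl fun k _ => by ring
      _ = _ := h
      _ = _ := by
          rw [mul_sum, sum_mul]
          exact sum_congr rfl fun k _ => by ring
  have h := congrArg (fun f => Polynomial.coeff f (k + 1)) hPQ
  simpa [P, Q, Polynomial.finsetSum_coeff, Polynomial.coeff_monomial, hk] using h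

end Faulhaber

/-! ### Reduction of `p`-integral rationals modulo `p` -/

section Reduction

variable (p : ℕ) [hp : Fact p.Prime]

/-- The rational numbers whose denominator is prime to `p`. -/
def pIntegral : Subring ℚ where
  carrier := {q | (q.den : ZMod p) ≠ 0}
  one_mem' := by simp
  zero_mem' := by simp
  neg_mem' := by simp
  add_mem' := by
    intro a b ha hb h
    rw [ZMod.natCast_eq_zero_iff] at h
    have := h.trans (Rat.add_den_dvd a b)
    rw [← ZMod.natCast_eq_zero_iff, Nat.cast_mul] at this
    exact (mul_ne_zero ha hb) this
  mul_mem' := by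
    intro a b ha hb h
    rw [ZMod.natCast_eq_zero_iff] at h
    have := h.trans (Rat.mul_den_dvd a b)
    rw [← ZMod.natCast_eq_zero_iff, Nat.cast_mul] at this
    exact (mul_ne_zero ha hb) this

variable {p}

theorem mem_pIntegral {q : ℚ} : q ∈ pIntegral p ↔ (q.den : ZMod p) ≠ 0 := Iff.rfl

variable (p)

/-- Reduction modulo `p`. -/
def pIntegral.toZMod : pIntegral p →+* ZMod p where
  toFun q := ((q : ℚ) : ZMod p)
  map_one' := by simp
  map_zero' := by simp
  map_add' a b := Rat.cast_add_of_ne_zero a.2 b.2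
  map_mul' a b := Rat.cast_mul_of_ne_zero a.2 b.2

variable {p}

theorem pIntegral.toZMod_apply (q : pIntegral p) : pIntegral.toZMod p q = ((q : ℚ) : ZMod p) := rfl

theorem natCast_ne_zero_of_lt {n : ℕ} (h0 : 0 < n) (hn : n < p) : (n : ZMod p) ≠ 0 := by
  rw [Ne, ZMod.natCast_eq_zero_iff]
  exact Nat.not_dvd_of_pos_of_lt h0 hn

theorem inv_natCast_mem_pIntegral {n : ℕ} (hn : n < p) : (n : ℚ)⁻¹ ∈ pIntegral p := by
  rcases Nat.eq_zero_or_pos n with rfl | h0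
  · simp
  · rw [mem_pIntegral, Rat.inv_natCast_den_of_pos h0]
    exact natCast_ne_zero_of_lt h0 hn

theorem natCast_mem_pIntegral (n : ℕ) : (n : ℚ) ∈ pIntegral p := natCast_mem _ n

/-- The denominators in the recursion for `bernoulli'` are at most n + 1, hence prime to p. -/
theorem bernoulli'_mem_pIntegral (n : ℕ) (hn : n + 1 < p) : bernoulli' n ∈ pIntegral p := by
  induction n using Nat.strong_induction_on with
  | _ n ih =>
    rw [bernoulli'_def]
    refine sub_mem (one_mem _) (sum_mem fun k hk => ?_)
    rw [mem_range] at hk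
    refine mul_mem ?_ (ih k hk (by omega))
    have : ((n : ℚ) - k + 1) = ((n - k + 1 : ℕ) : ℚ) := by
      push_cast [Nat.cast_sub hk.le]
      ring
    rw [this, div_eq_mul_inv]
    exact mul_mem (natCast_mem_pIntegral _) (inv_natCast_mem_pIntegral (by omega))

theorem faulhaberCoeff_mem_pIntegral (k v : ℕ) (hv : v + 1 < p) :
    faulhaberCoeff k v ∈ pIntegral p := by
  rw [faulhaberCoeff, div_eq_mul_inv]
  exact_mod_cast mul_mem (mul_mem (bernoulli'_mem_pIntegral _ (by omega)) (natCast_mem_pIntegral _))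
    (inv_natCast_mem_pIntegral (n := v + 1) hv)

theorem ratCast_inv_natCast {n : ℕ} (hn : n < p) : (((n : ℚ)⁻¹ : ℚ) : ZMod p) = (n : ZMod p)⁻¹ := by
  rcases Nat.eq_zero_or_pos n with rfl | h0
  · simp
  · refine eq_inv_of_mul_eq_one_left ?_
    have h := map_mul (pIntegral.toZMod p) ⟨_, inv_natCast_mem_pIntegral hn⟩
      ⟨_, natCast_mem_pIntegral n⟩
    simp only [pIntegral.toZMod_apply, MulMemClass.mk_mul_mk, Rat.cast_natCast] at h
    rw [← h, inv_mul_cancel₀ (by positivity), Rat.cast_one]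

/-- The values of `m ↦ 1 / m` as `p`-integral numbers. -/
noncomputable def pIntegralInv (p : ℕ) [Fact p.Prime] (m : ℕ) : pIntegral p :=
  if h : m < p then ⟨(m : ℚ)⁻¹, inv_natCast_mem_pIntegral h⟩ else 0

/-- The residues of `1 / m` modulo `p`. -/
def invMod (p m : ℕ) : ZMod p := (m : ZMod p)⁻¹

theorem toZMod_powChain (l : ℕ) (ks : List ℕ) {N : ℕ} (hN : N ≤ p) :
    pIntegral.toZMod p (powChain (pIntegralInv p) l ks N) = powChain (invMod p) l ks N := by
  rw [map_powChain]
  refine powChain_congr (fun m _ hm => ?_) _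
  have hm' : m < p := by omega
  simp [pIntegralInv, hm', pIntegral.toZMod_apply, ratCast_inv_natCast hm', invMod]

theorem coe_powChain (l : ℕ) (ks : List ℕ) {N : ℕ} (hN : N ≤ p) :
    ((powChain (pIntegralInv p) l ks N : pIntegral p) : ℚ) =
      powChain (fun m => (m : ℚ)⁻¹) l ks N := by
  rw [← Subring.coe_subtype, map_powChain]
  refine powChain_congr (fun m _ hm => ?_) _
  have hm' : m < p := by omega
  simp [pIntegralInv, hm']

/-- The reduction modulo `p` of `faulhaberCoeff`. -/
noncomputable def faulhaberMod (p : ℕ) [Fact p.Prime] (k v : ℕ) : ZMod p :=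
  ((faulhaberCoeff k v : ℚ) : ZMod p)

theorem faulhaberMod_of_lt {k v : ℕ} (h : v < k) : faulhaberMod p k v = 0 := by
  rw [faulhaberMod, faulhaberCoeff_of_lt h, Rat.cast_zero]

/-- The rational identity has p-integral coefficients for v ≤ p - 2 and so can be reduced modulo p.
Longer chains below n < p are empty, so nothing is lost by stopping there. -/
theorem sum_faulhaberMod_mul_powChain {n k : ℕ} (hn : 1 ≤ n) (hnp : n < p) (hk : k + 1 < p) :
    ∑ v ∈ Finset.range (p - 1), (-1) ^ (v + k) * faulhaberMod p k v *
        powChain (invMod p) 0 (List.replicate v 1) n =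
      invMod p n * powChain (invMod p) 0 (List.replicate k 1) n := by
  have key : ∑ v ∈ (Finset.range (p - 1)).attach, (-1) ^ ((v : ℕ) + k) *
        (⟨faulhaberCoeff k v, faulhaberCoeff_mem_pIntegral k v
          (by have := mem_range.1 v.2; omega)⟩ : pIntegral p) *
        powChain (pIntegralInv p) 0 (List.replicate (v : ℕ) 1) n =
      pIntegralInv p n * powChain (pIntegralInv p) 0 (List.replicate k 1) n := by
    apply Subtype.val_injective
    push_cast
    simp only [coe_powChain _ _ hnp.le]
    rw [sum_attach (Finset.range (p - 1)) (fun v => (-1 : ℚ) ^ (v + k) * faulhaberCoeff k v *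
      powChain (fun m => (m : ℚ)⁻¹) 0 (List.replicate v 1) n)]
    have h := sum_faulhaberCoeff_mul_powChain_rat hn (show n ≤ p - 1 by omega) k (by omega)
    calc _ = (-1) ^ k * ∑ v ∈ Finset.range (p - 1), (-1) ^ v * faulhaberCoeff k v *
          powChain (fun m => (m : ℚ)⁻¹) 0 (List.replicate v 1) n := by
          rw [mul_sum]
          exact sum_congr rfl fun v _ => by ring
      _ = _ := by
          rw [h, ← mul_assoc, ← mul_pow]
          simp [pIntegralInv, hnp]
  have h := congrArg (pIntegral.toZMod p) key
  rw [map_mul, map_sum] at h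
  simp only [map_mul, map_pow, map_neg, map_one, toZMod_powChain _ _ hnp.le] at h
  rw [← sum_attach]
  refine h.trans ?_
  congr 1
  simp [pIntegralInv, hnp, pIntegral.toZMod_apply, ratCast_inv_natCast hnp, invMod]

end Reduction

/-! ### Power chains modulo `p` and Bernoulli numbers -/

theorem powChain_eq_zero {R : Type*} [CommRing R] (z : ℕ → R) (l : ℕ) (ks : List ℕ) {N : ℕ}
    (h : N < l + 1 + ks.length) (h0 : ks ≠ []) : powChain z l ks N = 0 := by
  induction ks generalizing N with
  | nil => exact absurd rfl h0
  | cons k ks ih =>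
    rw [powChain_cons]
    refine sum_eq_zero fun n hn => ?_
    rw [mem_Ioo] at hn
    rw [List.length_cons] at h
    by_cases hks : ks = []
    · simp only [hks, List.length_nil] at h
      omega
    · rw [ih (by omega) hks, mul_zero]

section ModP

variable {p : ℕ} [hp : Fact p.Prime]

theorem prod_one_sub_mul_invMod (x : ZMod p) :
    ∏ m ∈ Ioo 0 p, (1 - x * invMod p m) = 1 - x ^ (p - 1) := by
  have hp1 := hp.out.one_lt
  by_cases hx : x = 0
  · subst hx
    rw [zero_pow (by omega)]
    simp
  · rw [ZMod.pow_card_sub_one_eq_one hx, sub_self]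
    refine prod_eq_zero (i := x.val) ?_ ?_
    · rw [mem_Ioo]
      exact ⟨Nat.pos_of_ne_zero ((ZMod.val_ne_zero x).2 hx), ZMod.val_lt x⟩
    · rw [invMod, ZMod.natCast_zmod_val, mul_inv_cancel₀ hx, sub_self]

/-- Two polynomials of degree below p that agree at all p residues, by Fermat's little theorem, are
equal. Their coefficients give the elementary symmetric functions of the 1/m. -/
theorem sum_monomial_powChain_prime :
    ∑ q ∈ Finset.range p, Polynomial.monomial q
      ((-1) ^ q * powChain (invMod p) 0 (List.replicate q 1) p) = 1 - Polynomial.X ^ (p - 1) := by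
  have hp1 := hp.out.one_lt
  refine Polynomial.eq_of_degree_sub_lt_of_eval_finset_eq univ ?_ fun x _ => ?_
  · rw [card_univ, ZMod.card]
    refine lt_of_le_of_lt (Polynomial.degree_sub_le _ _) (max_lt ?_ ?_)
    · refine lt_of_le_of_lt (Polynomial.degree_sum_le _ _) ((Finset.sup_lt_iff
        (WithBot.bot_lt_coe p)).2 fun q hq => ?_)
      exact (Polynomial.degree_monomial_le _ _).trans_lt (WithBot.coe_lt_coe.2 (mem_range.1 hq))
    · refine lt_of_le_of_lt (Polynomial.degree_sub_le _ _) (max_lt ?_ ?_)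
      · exact Polynomial.degree_one_le.trans_lt (by exact_mod_cast hp.out.pos)
      · refine (Polynomial.degree_X_pow_le _).trans_lt ?_
        have : p - 1 < p := by omega
        exact_mod_cast this
  · have h := prod_one_sub_eq_sum_powChain (K := p) x (invMod p) (l := 0) (N := p) (by omega)
    rw [sum_range_succ, powChain_replicate_eq_zero _ (by omega) (by omega),
      prod_one_sub_mul_invMod] at h
    simp [Polynomial.eval_finsetSum, Polynomial.eval_monomial, h]

theorem powChain_replicate_one_prime {q : ℕ} (hq : q ≠ 0) (hqp : q ≠ p - 1) :
    powChain (invMod p) 0 (List.replicate q 1) p = 0 := by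
  rcases Nat.lt_or_ge q p with h | h
  · have := congrArg (fun f => Polynomial.coeff f q) (sum_monomial_powChain_prime (p := p))
    simpa [Polynomial.finsetSum_coeff, Polynomial.coeff_monomial, h, Polynomial.coeff_one,
      Polynomial.coeff_X_pow, hq, hqp] using this
  · exact powChain_replicate_eq_zero _ (by omega) hq

theorem powChain_replicate_one_prime_sub_one :
    (-1) ^ (p - 1) * powChain (invMod p) 0 (List.replicate (p - 1) 1) p = -1 := by
  have hp1 := hp.out.one_lt
  have := congrArg (fun f => Polynomial.coeff f (p - 1)) (sum_monomial_powChain_prime (p := p))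
  have h0 : p - 1 ≠ 0 := by omega
  simp only [Polynomial.finsetSum_coeff, Polynomial.coeff_monomial, Polynomial.coeff_sub,
    Polynomial.coeff_one, Polynomial.coeff_X_pow, if_neg h0, sum_ite_eq', mem_range,
    if_pos (show p - 1 < p by omega), if_true, zero_sub] at this
  exact this

/-- The factor 1/n of the marked member is absorbed into the tail of ones below it. This lowers the
marked exponent by one at the price of a sum over tail lengths. -/
theorem powChain_succ_replicate (ks : List ℕ) (c : ℕ) {k : ℕ} (hk : k + 1 < p) :
    powChain (invMod p) 0 (ks ++ (c + 1) :: List.replicate k 1) p =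
      ∑ v ∈ Finset.range (p - 1), (-1) ^ (v + k) * faulhaberMod p k v *
        powChain (invMod p) 0 (ks ++ c :: List.replicate v 1) p := by
  simp only [powChain_append_cons, mul_sum]
  rw [sum_comm]
  refine sum_congr rfl fun n hn => ?_
  rw [mem_Ioo] at hn
  rw [pow_succ, mul_assoc, mul_assoc, ← sum_faulhaberMod_mul_powChain hn.1 hn.2 hk, mul_sum,
    mul_sum]
  exact sum_congr rfl fun v _ => by ring

theorem neg_one_pow_congr {R : Type*} [Ring R] {a b : ℕ} (h : Even (a + b)) :
    (-1 : R) ^ a = (-1) ^ b := by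
  rw [Nat.even_add] at h
  rcases Nat.even_or_odd a with ha | ha
  · rw [ha.neg_one_pow, (h.1 ha).neg_one_pow]
  · rw [ha.neg_one_pow,
      (Nat.not_even_iff_odd.1 fun hb => Nat.not_even_iff_odd.2 ha (h.2 hb)).neg_one_pow]

/-- Lowering the 2 leaves chains of ones of length a + 1 + v, and only the length p - 1 survives, so
v = p - 2 - a. -/
theorem powChain_two_eq_faulhaberMod {a : ℕ} (ha : a + 2 ≤ p) (k : ℕ) :
    powChain (invMod p) 0 (List.replicate a 1 ++ 2 :: List.replicate k 1) p =
      (-1) ^ (a + k) * faulhaberMod p k (p - 2 - a) := by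
  rcases Nat.lt_or_ge (k + 1) p with hk | hk
  · have hS := powChain_replicate_one_prime_sub_one (p := p)
    rw [powChain_succ_replicate _ 1 hk, sum_eq_single_of_mem (p - 2 - a) (by rw [mem_range]; omega)]
    · have : List.replicate a 1 ++ 1 :: List.replicate (p - 2 - a) 1 =
          List.replicate (p - 1) 1 := by
        rw [← List.replicate_succ, List.replicate_append_replicate]
        congr 1
        omega
      rw [this]
      have hsq : ((-1 : ZMod p) ^ (p - 1)) * (-1) ^ (p - 1) = 1 := by
        rw [← mul_pow]
        simp
      have hval : powChain (invMod p) 0 (List.replicate (p - 1) 1) p = -(-1) ^ (p - 1) := by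
        linear_combination (-1) ^ (p - 1) * hS -
          powChain (invMod p) 0 (List.replicate (p - 1) 1) p * hsq
      have hsign : (-1 : ZMod p) ^ (p - 2 - a + k) * -(-1) ^ (p - 1) = (-1) ^ (a + k) := by
        rw [mul_neg, ← pow_add, ← neg_one_mul, ← pow_succ']
        exact neg_one_pow_congr ⟨p - 1 + k, by omega⟩
      rw [hval, ← hsign]
      ring
    · intro v _ hv
      rw [← List.replicate_succ, List.replicate_append_replicate,
        powChain_replicate_one_prime (by omega) (by omega), mul_zero]
  · rw [faulhaberMod_of_lt (by omega), mul_zero]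
    exact powChain_eq_zero _ _ _ (by simp; omega) (by simp)

/-- The component at `p` of `β_w`. -/
noncomputable def betaMod (p : ℕ) [Fact p.Prime] (w : ℕ) : ZMod p :=
  ((bernoulli' (p - w) / w : ℚ) : ZMod p)

theorem betaMod_eq {w : ℕ} (hw : 2 ≤ w) (hwp : w < p) :
    betaMod p w = ((bernoulli' (p - w) : ℚ) : ZMod p) * (w : ZMod p)⁻¹ := by
  have h := map_mul (pIntegral.toZMod p) ⟨_, bernoulli'_mem_pIntegral (p - w) (by omega)⟩
    ⟨_, inv_natCast_mem_pIntegral hwp⟩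
  simp only [pIntegral.toZMod_apply, MulMemClass.mk_mul_mk, ratCast_inv_natCast hwp] at h
  rw [betaMod, div_eq_mul_inv, h]

/-- For even w the index p - w is odd and at least 3. -/
theorem betaMod_of_even {w : ℕ} (hw : Even w) (hwp : w + 2 < p) : betaMod p w = 0 := by
  rw [betaMod, bernoulli'_eq_zero_of_odd _ (by omega), zero_div, Rat.cast_zero]
  have := hp.out.odd_of_ne_two (by omega)
  exact Nat.Odd.sub_even (by omega) this hw

theorem faulhaberMod_eq {k v : ℕ} (hv : v + 1 < p) :
    faulhaberMod p k v = ((bernoulli' (v - k) : ℚ) : ZMod p) * ((v + 1).choose (k + 1) : ZMod p) *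
      ((v + 1 : ℕ) : ZMod p)⁻¹ := by
  have h := map_mul (pIntegral.toZMod p) (⟨_, bernoulli'_mem_pIntegral (v - k) (by omega)⟩ *
    ⟨_, natCast_mem_pIntegral ((v + 1).choose (k + 1))⟩) ⟨_, inv_natCast_mem_pIntegral hv⟩
  rw [map_mul (pIntegral.toZMod p) ⟨bernoulli' (v - k), _⟩] at h
  simp only [pIntegral.toZMod_apply, MulMemClass.mk_mul_mk, ratCast_inv_natCast hv,
    Rat.cast_natCast] at h
  rw [← h, faulhaberMod, faulhaberCoeff, div_eq_mul_inv]
  push_cast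
  rfl

theorem faulhaberMod_of_odd {k v : ℕ} (h : Odd (v - k)) (h1 : v - k ≠ 1) :
    faulhaberMod p k v = 0 := by
  rw [faulhaberMod, faulhaberCoeff, bernoulli'_eq_zero_of_odd h (by have := h.pos; omega)]
  simp

theorem two_mul_faulhaberMod_succ (k : ℕ) (hk : k + 2 < p) :
    2 * faulhaberMod p k (k + 1) = 1 := by
  have h2 : (2 : ZMod p) ≠ 0 := by
    exact_mod_cast natCast_ne_zero_of_lt (p := p) (n := 2) (by omega) (by omega)
  have hk' := natCast_ne_zero_of_lt (p := p) (n := k + 2) (by omega) (by omega)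
  have hb : ((bernoulli' 1 : ℚ) : ZMod p) = 2⁻¹ := by
    have := ratCast_inv_natCast (p := p) (n := 2) (by omega)
    rw [bernoulli'_one]
    simpa using this
  rw [faulhaberMod_eq (by omega), Nat.add_sub_cancel_left, hb,
    show (k + 1 + 1).choose (k + 1) = k + 2 by simp, mul_assoc, mul_inv_cancel₀ hk', mul_one,
    mul_inv_cancel₀ h2]

/-- Modulo p the upper index is -1 - a, and C(-1-a, k) = (-1)^k C(a+k, k). -/
theorem choose_prime_sub_succ {a : ℕ} (ha : a + 1 ≤ p) (k : ℕ) (hk : k < p) :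
    ((p - 1 - a).choose k : ZMod p) = (-1) ^ k * ((a + k).choose k : ZMod p) := by
  induction k with
  | zero => simp
  | succ k ih =>
    have hk' := natCast_ne_zero_of_lt (p := p) (n := k + 1) (by omega) hk
    refine mul_right_cancel₀ hk' ?_
    have h1 : ((p - 1 - a).choose (k + 1) : ZMod p) * ((k + 1 : ℕ) : ZMod p) =
        (p - 1 - a).choose k * (-(a + 1 + k : ℕ)) := by
      rcases Nat.lt_or_ge (p - 1 - a) k with h | h
      · rw [Nat.choose_eq_zero_of_lt h, Nat.choose_eq_zero_of_lt (by omega)]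
        simp
      · have h' := congrArg (Nat.cast (R := ZMod p)) (Nat.choose_succ_right_eq (p - 1 - a) k)
        rw [Nat.cast_mul, Nat.cast_mul] at h'
        rw [h', show p - 1 - a - k = p - (a + 1 + k) by omega, Nat.cast_sub (by omega),
          CharP.cast_eq_zero (ZMod p) p, zero_sub]
    have h2 : ((a + (k + 1)).choose (k + 1) : ZMod p) * ((k + 1 : ℕ) : ZMod p) =
        (a + k).choose k * ((a + 1 + k : ℕ) : ZMod p) := by
      have h := congrArg (Nat.cast (R := ZMod p)) (Nat.add_one_mul_choose_eq (a + k) k)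
      push_cast at h ⊢
      rw [show a + (k + 1) = a + k + 1 by omega, ← h]
      ring
    rw [h1, ih (by omega), mul_assoc ((-1) ^ (k + 1)), h2]
    ring

theorem faulhaberMod_eq_betaMod {a k w : ℕ} (hw : a + k + 2 = w) (hwp : w < p) :
    faulhaberMod p k (p - 2 - a) = (-1) ^ k * (w.choose (a + 1) : ZMod p) * betaMod p w := by
  have ha := natCast_ne_zero_of_lt (p := p) (n := p - 2 - a + 1) (by omega) (by omega)
  have hw0 := natCast_ne_zero_of_lt (p := p) (n := w) (by omega) (by omega)
  rw [faulhaberMod_eq (by omega), betaMod_eq (by omega) hwp,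
    show p - 2 - a - k = p - w by omega]
  have h1 : ((p - 2 - a + 1 : ℕ) : ZMod p) = -(a + 1 : ℕ) := by
    rw [show p - 2 - a + 1 = p - (a + 1) by omega, Nat.cast_sub (by omega), CharP.cast_eq_zero]
    ring
  have h2 : ((p - 2 - a + 1).choose (k + 1) : ZMod p) =
      (-1) ^ (k + 1) * ((w - 1).choose (k + 1) : ZMod p) := by
    rw [show p - 2 - a + 1 = p - 1 - a by omega, choose_prime_sub_succ (by omega) _ (by omega),
      show a + (k + 1) = w - 1 by omega]
  have h3 : (w : ZMod p) * ((w - 1).choose (k + 1) : ZMod p) = w.choose (a + 1) * (a + 1 : ℕ) := by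
    have h := Nat.add_one_mul_choose_eq (a + k + 1) a
    rw [← Nat.choose_symm (show k + 1 ≤ w - 1 by omega), show w - 1 - (k + 1) = a by omega]
    rw [show a + k + 1 + 1 = w by omega, show a + k + 1 = w - 1 by omega] at h
    rw [← Nat.cast_mul, ← Nat.cast_mul, h]
  have key : ((p - 2 - a + 1).choose (k + 1) : ZMod p) * w =
      (-1) ^ k * (w.choose (a + 1) : ZMod p) * ((p - 2 - a + 1 : ℕ) : ZMod p) := by
    rw [h1, h2]
    linear_combination (-1) ^ (k + 1) * h3
  field_simp
  linear_combination ((bernoulli' (p - w) : ℚ) : ZMod p) * key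

theorem powChain_two {a k w : ℕ} (hw : a + k + 2 = w) (hwp : w < p) :
    powChain (invMod p) 0 (List.replicate a 1 ++ 2 :: List.replicate k 1) p =
      (-1) ^ a * (w.choose (a + 1) : ZMod p) * betaMod p w := by
  rw [powChain_two_eq_faulhaberMod (by omega), faulhaberMod_eq_betaMod hw hwp, pow_add]
  have : ((-1 : ZMod p) ^ k) * (-1) ^ k = 1 := by
    rw [← mul_pow]
    simp
  linear_combination (-1) ^ a * (w.choose (a + 1) : ZMod p) * betaMod p w * this

/-- A double sum of products of two Bernoulli numbers, in which for parity reasons only the terms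
with a factor `B_1` survive. -/
theorem sum_faulhaberMod_mul_powChain_two {a q k w : ℕ} (hw : a + q + k + 3 = w) (hodd : Odd w)
    (hwp : w + 2 < p) :
    2 * ∑ v ∈ Finset.range (p - 1), (-1) ^ (v + k) * faulhaberMod p k v *
        powChain (invMod p) 0 (List.replicate a 1 ++ 2 :: List.replicate (q + v) 1) p =
      ((-1) ^ k * (w.choose (k + 1) : ZMod p) - (-1) ^ a * (w.choose (a + 1) : ZMod p)) *
        betaMod p w := by
  have hpodd := hp.out.odd_of_ne_two (by omega)
  have hpodd' := Nat.odd_iff.1 hpodd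
  have hodd' := Nat.odd_iff.1 hodd
  have hterm : ∀ v, (-1 : ZMod p) ^ (v + k) * faulhaberMod p k v *
      powChain (invMod p) 0 (List.replicate a 1 ++ 2 :: List.replicate (q + v) 1) p =
      (-1) ^ (a + q + k) * (faulhaberMod p k v * faulhaberMod p (q + v) (p - 2 - a)) := by
    intro v
    rw [powChain_two_eq_faulhaberMod (by omega)]
    have : (-1 : ZMod p) ^ (v + k) * (-1) ^ (a + (q + v)) = (-1) ^ (a + q + k) := by
      rw [← pow_add]
      exact neg_one_pow_congr ⟨a + q + k + v, by omega⟩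
    rw [← this]
    ring
  simp only [hterm]
  -- The Bernoulli indices v - k and p - 2 - a - (q + v) add up to p - w + 1, which is odd, so one
  -- of them is odd and its Bernoulli number vanishes unless that index is 1. This leaves v = k + 1
  -- and v = p - 3 - a - q, distinct because p ≠ w + 1.
  rw [← mul_sum, sum_eq_add_of_mem (k + 1) (p - 3 - a - q) (by rw [mem_range]; omega)
    (by rw [mem_range]; omega) (by omega)]
  · have e1 := two_mul_faulhaberMod_succ (p := p) k (by omega)
    have e2 := two_mul_faulhaberMod_succ (p := p) (q + (p - 3 - a - q)) (by omega)
    rw [show q + (p - 3 - a - q) + 1 = p - 2 - a by omega] at e2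
    have e3 : faulhaberMod p (q + (k + 1)) (p - 2 - a) = _ :=
      faulhaberMod_eq_betaMod (w := w) (by omega) (by omega)
    have e4 : faulhaberMod p k (p - 2 - (a + q + 1)) = _ :=
      faulhaberMod_eq_betaMod (w := w) (by omega) (by omega)
    rw [show p - 2 - (a + q + 1) = p - 3 - a - q by omega,
      Nat.choose_symm_of_eq_add (show w = a + q + 1 + 1 + (k + 1) by omega)] at e4
    have s1 : (-1 : ZMod p) ^ (a + q + k) = 1 := Even.neg_one_pow ⟨(a + q + k) / 2, by omega⟩
    have s2 : (-1 : ZMod p) ^ (q + (k + 1)) = -(-1) ^ a := by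
      rw [← neg_one_mul ((-1 : ZMod p) ^ a), ← pow_succ']
      exact neg_one_pow_congr ⟨(a + q + k + 2) / 2, by omega⟩
    rw [s2] at e3
    rw [s1]
    linear_combination faulhaberMod p (q + (k + 1)) (p - 2 - a) * e1 +
      faulhaberMod p k (p - 3 - a - q) * e2 + e3 + e4
  · intro v hv hne
    rw [mem_range] at hv
    rcases Nat.lt_or_ge v k with h1 | h1
    · rw [faulhaberMod_of_lt h1, zero_mul]
    · rcases Nat.lt_or_ge (p - 2 - a) (q + v) with h2 | h2
      · rw [faulhaberMod_of_lt h2, mul_zero]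
      · rcases Nat.even_or_odd (v - k) with he | ho
        · rw [faulhaberMod_of_odd (k := q + v), mul_zero]
          · rw [Nat.even_iff] at he
            rw [Nat.odd_iff]
            omega
          · have := hne.2
            omega
        · rw [faulhaberMod_of_odd ho (by have := hne.1; omega), zero_mul]

end ModP

/-- The coefficients that express chain sums of `y / (1 - y)` through chain sums of `y`. -/
def signedChoose (q r : ℕ) : ℤ := (-1) ^ (q + r) * q.choose r

/-! ### Clearing the denominators 1 - y in chain sums -/

section Expansion

variable {R : Type*} [CommRing R] {f y : ℕ → R}

theorem expand_replicate {l K N : ℕ} (r : ℕ)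
    (hf : ∀ m, l < m → m < N → f m * (1 - y m) = y m) (hK : N ≤ l + K) :
    (∏ m ∈ Ioo l N, (1 - y m)) * chainSum l (List.replicate r f) N =
      ∑ q ∈ Finset.range (K + 1), signedChoose q r • powChain y l (List.replicate q 1) N := by
  rw [prod_one_sub_mul_chainSum_replicate r N (fun _ => hf) hK]
  refine sum_congr rfl fun q _ => ?_
  rw [powChain_replicate_one, signedChoose, zsmul_eq_mul]
  push_cast
  ring

theorem prod_Ioo_split {g : ℕ → R} {l n N : ℕ} (h1 : l < n) (h2 : n < N) :
    ∏ m ∈ Ioo l N, g m = (∏ m ∈ Ioo n N, g m) * g n * ∏ m ∈ Ioo l n, g m := by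
  have : Ioo l N = insert n (Ioo n N ∪ Ioo l n) := by
    ext m
    simp only [mem_Ioo, mem_insert, mem_union]
    omega
  rw [this, prod_insert (by simp), prod_union]
  · ring
  · rw [disjoint_left]
    intro m
    simp only [mem_Ioo]
    omega

/-- An expansion into power chains propagates through a marked member `g = y ^ c / (1 - y)`. -/
theorem expand_append_cons {ι : Type*} {g : ℕ → R} {l K N c : ℕ} (r : ℕ) (I : Finset ι)
    (a : ι → ℤ) (ks : ι → List ℕ) (L : List (ℕ → R))
    (hf : ∀ m, l < m → m < N → f m * (1 - y m) = y m)
    (hg : ∀ m, l < m → m < N → g m * (1 - y m) = y m ^ c) (hK : N ≤ l + K)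
    (hL : ∀ n, l < n → n < N → (∏ m ∈ Ioo l n, (1 - y m)) * chainSum l L n =
      ∑ i ∈ I, a i • powChain y l (ks i) n) :
    (∏ m ∈ Ioo l N, (1 - y m)) * chainSum l (List.replicate r f ++ g :: L) N =
      ∑ q ∈ Finset.range (K + 1), ∑ i ∈ I,
        (signedChoose q r * a i) • powChain y l (List.replicate q 1 ++ c :: ks i) N := by
  rw [chainSum_append_cons, mul_sum]
  -- The product is cut at the marked member n: its upper part clears the block of `f`'s, the factor
  -- at n clears `g`, and the lower part clears `L`.
  have h : ∀ n ∈ Ioo l N, (∏ m ∈ Ioo l N, (1 - y m)) *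
      (chainSum n (List.replicate r f) N * g n * chainSum l L n) =
      ∑ q ∈ Finset.range (K + 1), ∑ i ∈ I, (signedChoose q r * a i) •
        (powChain y n (List.replicate q 1) N * y n ^ c * powChain y l (ks i) n) := by
    intro n hn
    rw [mem_Ioo] at hn
    have h1 := expand_replicate (l := n) (K := K) r
      (fun m h h' => hf m (hn.1.trans h) h') (show N ≤ n + K by omega)
    calc _ = ((∏ m ∈ Ioo n N, (1 - y m)) * chainSum n (List.replicate r f) N) *
          (g n * (1 - y n)) * ((∏ m ∈ Ioo l n, (1 - y m)) * chainSum l L n) := by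
          rw [prod_Ioo_split hn.1 hn.2]
          ring
      _ = _ := by
          rw [h1, hg n hn.1 hn.2, hL n hn.1 hn.2, sum_mul, sum_mul]
          refine sum_congr rfl fun q _ => ?_
          rw [mul_sum]
          refine sum_congr rfl fun i _ => ?_
          simp only [zsmul_eq_mul, Int.cast_mul]
          ring
  rw [sum_congr rfl h, sum_comm]
  refine sum_congr rfl fun q _ => ?_
  rw [sum_comm]
  refine sum_congr rfl fun i _ => ?_
  rw [powChain_append_cons, smul_sum]

end Expansion

/-! ### Generating series modulo `X ^ (p - 1)` -/

section Series

open PowerSeries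

variable {p : ℕ} [hp : Fact p.Prime]

/-- The power series `X / m` over `ℤ/pℤ`. -/
noncomputable def varDiv (p : ℕ) [Fact p.Prime] (m : ℕ) : (ZMod p)⟦X⟧ := X * C (invMod p m)

/-- The power series `∑_{k ≥ e} (X / m) ^ k` over `ℤ/pℤ`. -/
noncomputable def geomTail (p : ℕ) [Fact p.Prime] (e m : ℕ) : (ZMod p)⟦X⟧ :=
  PowerSeries.mk fun k => if e ≤ k then invMod p m ^ k else 0

theorem geomTail_succ (e m : ℕ) : geomTail p (e + 1) m = varDiv p m * geomTail p e m := by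
  ext k
  rw [varDiv, mul_assoc, mul_comm X]
  cases k with
  | zero => simp [geomTail]
  | succ k => simp [geomTail, coeff_succ_mul_X, pow_succ']

theorem geomTail_zero_mul (m : ℕ) : geomTail p 0 m * (1 - varDiv p m) = 1 := by
  have h : geomTail p 0 m = 1 + geomTail p 1 m := by
    ext k
    simp only [geomTail, coeff_mk, map_add, coeff_one]
    cases k <;> simp
  rw [geomTail_succ] at h
  linear_combination h

theorem geomTail_mul (e m : ℕ) : geomTail p e m * (1 - varDiv p m) = varDiv p m ^ e := by
  induction e with
  | zero => rw [geomTail_zero_mul, pow_zero]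
  | succ e ih => rw [geomTail_succ, mul_assoc, ih, pow_succ']

theorem powChain_varDiv (l : ℕ) (ks : List ℕ) (N : ℕ) :
    powChain (varDiv p) l ks N = X ^ ks.sum * C (powChain (invMod p) l ks N) := by
  rw [map_powChain]
  exact powChain_mul X _ l ks N

theorem coeff_powChain_varDiv (w l : ℕ) (ks : List ℕ) (N : ℕ) :
    coeff w (powChain (varDiv p) l ks N) =
      if ks.sum = w then powChain (invMod p) l ks N else 0 := by
  rw [powChain_varDiv, coeff_X_pow_mul', coeff_C]
  rcases lt_trichotomy ks.sum w with h | h | h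
  · rw [if_pos h.le, if_neg (by omega), if_neg (by omega)]
  · rw [if_pos h.le, if_pos (by omega), if_pos h]
  · rw [if_neg (by omega), if_neg (by omega)]

theorem X_pow_dvd_powChain_varDiv {q : ℕ} (hq : q ≠ 0) :
    (X : (ZMod p)⟦X⟧) ^ (p - 1) ∣ powChain (varDiv p) 0 (List.replicate q 1) p := by
  rw [powChain_varDiv]
  rcases Nat.lt_or_ge q (p - 1) with h | h
  · rw [powChain_replicate_one_prime hq h.ne]
    simp
  · exact dvd_mul_of_dvd_left (pow_dvd_pow _ (by simpa using h)) _

theorem X_pow_dvd_prod_sub_one :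
    (X : (ZMod p)⟦X⟧) ^ (p - 1) ∣ ∏ m ∈ Ioo 0 p, (1 - varDiv p m) - 1 := by
  have h := expand_replicate (R := (ZMod p)⟦X⟧) (f := geomTail p 1) (y := varDiv p) (l := 0)
    (N := p) (K := p) 0 (fun m _ _ => by rw [geomTail_mul, pow_one]) (by omega)
  rw [List.replicate_zero, chainSum_nil, mul_one, sum_range_succ'] at h
  rw [h]
  have : signedChoose 0 0 • powChain (varDiv p) 0 (List.replicate 0 1) p = 1 := by
    simp [signedChoose]
  rw [this, add_sub_cancel_right]
  refine dvd_sum fun q _ => ?_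
  exact dvd_smul_of_dvd _ (X_pow_dvd_powChain_varDiv (Nat.succ_ne_zero q))

/-- The product is 1 modulo X^(p-1), so it can be inserted freely to clear denominators in low
degrees. -/
theorem coeff_eq_coeff_prod_mul {w : ℕ} (hw : w < p - 1) (A : (ZMod p)⟦X⟧) :
    coeff w A = coeff w ((∏ m ∈ Ioo 0 p, (1 - varDiv p m)) * A) := by
  have h : (X : (ZMod p)⟦X⟧) ^ (p - 1) ∣ (∏ m ∈ Ioo 0 p, (1 - varDiv p m)) * A - A := by
    obtain ⟨B, hB⟩ := X_pow_dvd_prod_sub_one (p := p)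
    exact ⟨B * A, by linear_combination A * hB⟩
  have := X_pow_dvd_iff.1 h w hw
  rw [map_sub, sub_eq_zero] at this
  exact this.symm

/-- In the expansion into elementary symmetric functions the term q = 0 has coefficient C(0, r) = 0,
and every other term is divisible by X^(p-1). -/
theorem X_pow_dvd_chainSum_replicate {r : ℕ} (hr : r ≠ 0) :
    (X : (ZMod p)⟦X⟧) ^ (p - 1) ∣ chainSum 0 (List.replicate r (geomTail p 1)) p := by
  rw [X_pow_dvd_iff]
  intro w hw
  rw [coeff_eq_coeff_prod_mul hw]
  refine X_pow_dvd_iff.1 ?_ w hw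
  rw [expand_replicate (f := geomTail p 1) (y := varDiv p) (K := p) r
    (fun m _ _ => by rw [geomTail_mul, pow_one]) (by omega)]
  refine dvd_sum fun q _ => ?_
  rcases Nat.eq_zero_or_pos q with rfl | hq
  · have : signedChoose 0 r = 0 := by
      rw [signedChoose, Nat.choose_eq_zero_of_lt (Nat.pos_of_ne_zero hr)]
      simp
    rw [this, zero_smul]
    exact dvd_zero _
  · exact dvd_smul_of_dvd _ (X_pow_dvd_powChain_varDiv hq.ne')

/-- The chain sums in which one member, in position `r + 1`, has exponent at least `c`. -/
theorem coeff_chainSum_marked {w : ℕ} (hw : w < p - 1) (r s c : ℕ) :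
    coeff w (chainSum 0 (List.replicate r (geomTail p 1) ++
        geomTail p c :: List.replicate s (geomTail p 1)) p) =
      ∑ q ∈ Finset.range (p + 1), ∑ t ∈ Finset.range (p + 1), if q + t + c = w then
        (signedChoose q r * signedChoose t s) •
          powChain (invMod p) 0 (List.replicate q 1 ++ c :: List.replicate t 1) p else 0 := by
  rw [coeff_eq_coeff_prod_mul hw, expand_append_cons (f := geomTail p 1) (y := varDiv p) (K := p)
    (c := c) r (Finset.range (p + 1)) (fun t => signedChoose t s) (fun t => List.replicate t 1)]
  · simp only [map_sum, map_zsmul, coeff_powChain_varDiv, List.sum_append, List.sum_cons,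
      List.sum_replicate, smul_eq_mul, mul_one]
    refine sum_congr rfl fun q _ => sum_congr rfl fun t _ => ?_
    by_cases h : q + t + c = w
    · rw [if_pos h, if_pos (by omega)]
    · rw [if_neg h, if_neg (by omega), smul_zero]
  · exact fun m _ _ => by rw [geomTail_mul, pow_one]
  · exact fun m _ _ => geomTail_mul _ _
  · omega
  · exact fun n _ hn => expand_replicate (f := geomTail p 1) (y := varDiv p) (K := p) s
      (fun m _ _ => by rw [geomTail_mul, pow_one]) (by omega)

/-- The chain sums with two marked members. -/
theorem coeff_chainSum_marked₂ {w : ℕ} (hw : w < p - 1) (r g s c : ℕ) :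
    coeff w (chainSum 0 (List.replicate r (geomTail p 1) ++ geomTail p c ::
        (List.replicate g (geomTail p 1) ++ geomTail p c :: List.replicate s (geomTail p 1))) p) =
      ∑ q ∈ Finset.range (p + 1), ∑ u ∈ Finset.range (p + 1), ∑ t ∈ Finset.range (p + 1),
        if q + u + t + 2 * c = w then
          (signedChoose q r * signedChoose u g * signedChoose t s) •
            powChain (invMod p) 0 (List.replicate q 1 ++ c ::
              (List.replicate u 1 ++ c :: List.replicate t 1)) p else 0 := by
  have hf : ∀ m, geomTail p 1 m * (1 - varDiv p m) = varDiv p m :=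
    fun m => by rw [geomTail_mul, pow_one]
  rw [coeff_eq_coeff_prod_mul hw, expand_append_cons (f := geomTail p 1) (y := varDiv p) (K := p)
    (c := c) r (Finset.range (p + 1) ×ˢ Finset.range (p + 1))
    (fun x => signedChoose x.1 g * signedChoose x.2 s)
    (fun x => List.replicate x.1 1 ++ c :: List.replicate x.2 1)]
  · simp only [map_sum, map_zsmul, coeff_powChain_varDiv, List.sum_append, List.sum_cons,
      List.sum_replicate, smul_eq_mul, mul_one, sum_product]
    refine sum_congr rfl fun q _ => sum_congr rfl fun u _ => sum_congr rfl fun t _ => ?_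
    by_cases h : q + u + t + 2 * c = w
    · rw [if_pos h, if_pos (by omega), mul_assoc]
    · rw [if_neg h, if_neg (by omega), smul_zero]
  · exact fun m _ _ => hf m
  · exact fun m _ _ => geomTail_mul _ _
  · omega
  · intro n _ hn
    rw [sum_product]
    refine expand_append_cons (f := geomTail p 1) (y := varDiv p) (K := p) (c := c) g
      (Finset.range (p + 1)) (fun t => signedChoose t s) (fun t => List.replicate t 1) _
      (fun m _ _ => hf m) (fun m _ _ => geomTail_mul _ _) (by omega) ?_
    exact fun n' _ hn' => expand_replicate (f := geomTail p 1) (y := varDiv p) (K := p) s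
      (fun m _ _ => hf m) (by omega)

end Series

/-! ### Alternating binomial sums by finite differences -/

section Binomial

theorem sum_range_box {M : Type*} [AddCommMonoid M] {w c K : ℕ} (hK : w < K) (F : ℕ → ℕ → M) :
    ∑ q ∈ Finset.range K, ∑ t ∈ Finset.range K, (if q + t + c = w then F q t else 0) =
      ∑ q ∈ Finset.range (w + 1 - c), F q (w - c - q) := by
  rw [← sum_subset (range_subset_range.2 (show w + 1 - c ≤ K by omega))]
  · refine sum_congr rfl fun q hq => ?_
    rw [mem_range] at hq
    rw [sum_eq_single_of_mem (w - c - q) (by rw [mem_range]; omega), if_pos (by omega)]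
    exact fun t _ ht => if_neg (by omega)
  · intro q _ hq
    rw [mem_range] at hq
    exact sum_eq_zero fun t _ => if_neg (by omega)

theorem sum_range_choose_mul_choose (n a b : ℕ) :
    ∑ u ∈ Finset.range (n + 1), u.choose a * (n - u).choose b = (n + 1).choose (a + b + 1) := by
  induction n generalizing b with
  | zero =>
    rcases a with _ | a
    · rcases b with _ | b
      · simp
      · simp [Nat.choose_eq_zero_of_lt]
    · simp [Nat.choose_eq_zero_of_lt]
  | succ n ih =>
    rw [sum_range_succ]
    cases b with
    | zero =>
      have h := ih 0
      simp only [Nat.choose_zero_right, mul_one, add_zero] at h ⊢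
      rw [h, Nat.choose_succ_succ (n + 1) a, add_comm]
    | succ b =>
      have hs : ∀ u ∈ Finset.range (n + 1), u.choose a * (n + 1 - u).choose (b + 1) =
          u.choose a * (n - u).choose b + u.choose a * (n - u).choose (b + 1) := by
        intro u hu
        rw [mem_range] at hu
        rw [show n + 1 - u = n - u + 1 by omega, Nat.choose_succ_succ, mul_add]
      rw [sum_congr rfl hs, sum_add_distrib, ih, ih, Nat.sub_self, Nat.choose_zero_succ, mul_zero,
        add_zero, show a + (b + 1) + 1 = a + b + 1 + 1 by omega, ← Nat.choose_succ_succ]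

/-- The binomial coefficient `X.choose a` as a polynomial. -/
noncomputable def choosePoly : ℕ → Polynomial ℚ
  | 0 => 1
  | a + 1 => Polynomial.C ((a + 1 : ℚ)⁻¹) * (choosePoly a * (Polynomial.X - Polynomial.C (a : ℚ)))

theorem natDegree_choosePoly_le (a : ℕ) : (choosePoly a).natDegree ≤ a := by
  induction a with
  | zero => simp [choosePoly]
  | succ a ih =>
    rw [choosePoly]
    refine (Polynomial.natDegree_C_mul_le _ _).trans (Polynomial.natDegree_mul_le.trans ?_)
    exact add_le_add ih (Polynomial.natDegree_X_sub_C_le _)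

theorem eval_choosePoly_natCast (a n : ℕ) : (choosePoly a).eval (n : ℚ) = n.choose a := by
  induction a with
  | zero => simp [choosePoly]
  | succ a ih =>
    have ha : (a + 1 : ℚ) ≠ 0 := by positivity
    have h : (n.choose (a + 1) : ℚ) * (a + 1) = n.choose a * (n - a) := by
      rcases Nat.lt_or_ge n a with h | h
      · simp [Nat.choose_eq_zero_of_lt h, Nat.choose_eq_zero_of_lt (show n < a + 1 by omega)]
      · have := congrArg (Nat.cast (R := ℚ)) (Nat.choose_succ_right_eq n a)
        rw [Nat.cast_mul, Nat.cast_mul, Nat.cast_sub h] at this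
        exact_mod_cast this
    simp only [choosePoly, Polynomial.eval_mul, Polynomial.eval_C, Polynomial.eval_sub,
      Polynomial.eval_X, ih, ← h]
    field_simp

/-- Negative arguments, out of reach of `Nat.choose`, occur in the boundary terms of the finite
differences below. -/
theorem eval_choosePoly_neg_one (a : ℕ) : (choosePoly a).eval (-1) = (-1) ^ a := by
  induction a with
  | zero => simp [choosePoly]
  | succ a ih =>
    have ha : (a + 1 : ℚ) ≠ 0 := by positivity
    simp only [choosePoly, Polynomial.eval_mul, Polynomial.eval_C, Polynomial.eval_sub,
      Polynomial.eval_X, ih]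
    field_simp
    ring

theorem eval_choosePoly_neg_two (a : ℕ) : (choosePoly a).eval (-2) = (-1) ^ a * (a + 1) := by
  induction a with
  | zero => simp [choosePoly]
  | succ a ih =>
    have ha : (a + 1 : ℚ) ≠ 0 := by positivity
    simp only [choosePoly, Polynomial.eval_mul, Polynomial.eval_C, Polynomial.eval_sub,
      Polynomial.eval_X, ih]
    push_cast
    field_simp
    ring

/-- The sum is, up to sign, the n-th finite difference of a polynomial of degree below n. -/
theorem alternating_sum_choose_mul_eval {P : Polynomial ℚ} {n : ℕ} (hP : P.natDegree < n) :
    ∑ k ∈ Finset.range (n + 1), (-1) ^ k * (n.choose k : ℚ) * P.eval (k : ℚ) = 0 := by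
  have h := congrFun (Polynomial.fwdDiff_iter_eq_zero_of_degree_lt hP) 0
  rw [fwdDiff_iter_eq_sum_shift] at h
  have h2 : ∑ k ∈ Finset.range (n + 1), (-1) ^ k * (n.choose k : ℚ) * P.eval (k : ℚ) =
      (-1) ^ n * ∑ k ∈ Finset.range (n + 1), ((-1 : ℤ) ^ (n - k) * n.choose k) •
        P.eval (0 + k • (1 : ℚ)) := by
    rw [mul_sum]
    refine sum_congr rfl fun k hk => ?_
    rw [mem_range] at hk
    have : (-1 : ℚ) ^ k = (-1) ^ n * (-1) ^ (n - k) := by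
      rw [← pow_add]
      exact neg_one_pow_congr ⟨n, by omega⟩
    rw [this, zsmul_eq_mul]
    push_cast
    simp only [zero_add, nsmul_eq_mul, mul_one]
    ring
  rw [h2, h]
  simp

theorem alternating_sum_choose_mul_choosePoly {w a e : ℕ} (c : ℚ) (h : a + e < w) :
    ∑ k ∈ Finset.range (w + 1), (-1) ^ k * (w.choose k : ℚ) *
      ((choosePoly a).eval (k - 1 : ℚ) * (choosePoly e).eval (c - k)) = 0 := by
  have := alternating_sum_choose_mul_eval (n := w)
    (P := (choosePoly a).comp (Polynomial.X - Polynomial.C 1) *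
      (choosePoly e).comp (Polynomial.C c - Polynomial.X)) ?_
  · simpa [Polynomial.eval_comp] using this
  · refine lt_of_le_of_lt Polynomial.natDegree_mul_le (lt_of_le_of_lt (add_le_add
      Polynomial.natDegree_comp_le Polynomial.natDegree_comp_le) ?_)
    refine lt_of_le_of_lt (add_le_add (Nat.mul_le_mul (natDegree_choosePoly_le a)
      (Polynomial.natDegree_X_sub_C_le _)) (Nat.mul_le_mul (natDegree_choosePoly_le e)
      ((Polynomial.natDegree_sub_le _ _).trans (max_le (by simp) Polynomial.natDegree_X_le)))) ?_
    simpa using h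

/-- With k = r + 1, the summands are minus the interior terms of the w-th difference of C(k-1, a)
C(w-1-k, e). The right side consists of its boundary terms k = 0 and k = w, where C(-1, ·) appears.
-/
theorem sum_choose_mul_choose_mul_choose {w a e : ℕ} (hw : 2 ≤ w) (h : a + e < w) :
    ∑ r ∈ Finset.range (w - 1), (-1 : ℤ) ^ r * r.choose a * (w - 2 - r).choose e *
        w.choose (r + 1) =
      (-1) ^ a * (w - 1).choose e + (-1) ^ (w + e) * (w - 1).choose a := by
  obtain ⟨v, rfl⟩ : ∃ v, w = v + 2 := ⟨w - 2, by omega⟩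
  have key := alternating_sum_choose_mul_choosePoly ((v + 1 : ℕ) : ℚ) h
  rw [sum_range_succ, sum_range_succ'] at key
  have hmid : ∀ r ∈ Finset.range (v + 1), (-1 : ℚ) ^ (r + 1) * ((v + 2).choose (r + 1) : ℚ) *
      ((choosePoly a).eval (((r + 1 : ℕ) : ℚ) - 1) *
        (choosePoly e).eval (((v + 1 : ℕ) : ℚ) - ((r + 1 : ℕ) : ℚ))) =
      -((-1 : ℚ) ^ r * r.choose a * (v + 2 - 2 - r).choose e * (v + 2).choose (r + 1)) := by
    intro r hr
    rw [mem_range] at hr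
    have h1 : ((r + 1 : ℕ) : ℚ) - 1 = (r : ℚ) := by push_cast; ring
    have h2 : ((v + 1 : ℕ) : ℚ) - ((r + 1 : ℕ) : ℚ) = ((v + 2 - 2 - r : ℕ) : ℚ) := by
      rw [show v + 2 - 2 - r = v - r by omega, Nat.cast_sub (by omega)]
      push_cast
      ring
    rw [h1, h2, eval_choosePoly_natCast, eval_choosePoly_natCast]
    ring
  rw [sum_congr rfl hmid, sum_neg_distrib] at key
  have e1 : ((v + 2 : ℕ) : ℚ) - 1 = ((v + 1 : ℕ) : ℚ) := by push_cast; ring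
  have e2 : ((v + 1 : ℕ) : ℚ) - ((v + 2 : ℕ) : ℚ) = -1 := by push_cast; ring
  rw [e1, e2, Nat.cast_zero, zero_sub, sub_zero, eval_choosePoly_natCast, eval_choosePoly_natCast,
    eval_choosePoly_neg_one, eval_choosePoly_neg_one, Nat.choose_self, Nat.choose_zero_right] at key
  rw [show v + 2 - 1 = v + 1 by omega]
  have : ((∑ r ∈ Finset.range (v + 1), (-1 : ℤ) ^ r * r.choose a * (v + 2 - 2 - r).choose e *
        (v + 2).choose (r + 1) : ℤ) : ℚ) =
      (((-1) ^ a * (v + 1).choose e + (-1) ^ (v + 2 + e) * (v + 1).choose a : ℤ) : ℚ) := by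
    push_cast at key ⊢
    rw [pow_add _ (v + 2) e]
    linear_combination -key
  exact_mod_cast this

/-- The same argument for C(k-1, a) C(w-2-k, e); now k = 0, w - 1 and w are boundary terms, the last
two containing C(-1, e) and C(-2, e). -/
theorem sum_choose_mul_choose_mul_choose' {w a e : ℕ} (hw : 3 ≤ w) (h : a + e < w) :
    ∑ r ∈ Finset.range (w - 2), (-1 : ℤ) ^ r * r.choose a * (w - 3 - r).choose e *
        w.choose (r + 1) =
      (-1) ^ a * (w - 2).choose e + (-1) ^ (w + e) * ((e + 1) * (w - 1).choose a -
        w * (w - 2).choose a) := by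
  obtain ⟨v, rfl⟩ : ∃ v, w = v + 3 := ⟨w - 3, by omega⟩
  have key := alternating_sum_choose_mul_choosePoly ((v + 1 : ℕ) : ℚ) h
  rw [sum_range_succ, sum_range_succ, sum_range_succ'] at key
  have hmid : ∀ r ∈ Finset.range (v + 1), (-1 : ℚ) ^ (r + 1) * ((v + 3).choose (r + 1) : ℚ) *
      ((choosePoly a).eval (((r + 1 : ℕ) : ℚ) - 1) *
        (choosePoly e).eval (((v + 1 : ℕ) : ℚ) - ((r + 1 : ℕ) : ℚ))) =
      -((-1 : ℚ) ^ r * r.choose a * (v + 3 - 3 - r).choose e * (v + 3).choose (r + 1)) := by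
    intro r hr
    rw [mem_range] at hr
    have h1 : ((r + 1 : ℕ) : ℚ) - 1 = (r : ℚ) := by push_cast; ring
    have h2 : ((v + 1 : ℕ) : ℚ) - ((r + 1 : ℕ) : ℚ) = ((v + 3 - 3 - r : ℕ) : ℚ) := by
      rw [show v + 3 - 3 - r = v - r by omega, Nat.cast_sub (by omega)]
      push_cast
      ring
    rw [h1, h2, eval_choosePoly_natCast, eval_choosePoly_natCast]
    ring
  rw [sum_congr rfl hmid, sum_neg_distrib] at key
  have e1 : ((v + 3 : ℕ) : ℚ) - 1 = ((v + 2 : ℕ) : ℚ) := by push_cast; ring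
  have e2 : ((v + 1 : ℕ) : ℚ) - ((v + 3 : ℕ) : ℚ) = -2 := by push_cast; ring
  have e3 : ((v + 2 : ℕ) : ℚ) - 1 = ((v + 1 : ℕ) : ℚ) := by push_cast; ring
  have e4 : ((v + 1 : ℕ) : ℚ) - ((v + 2 : ℕ) : ℚ) = -1 := by push_cast; ring
  rw [e1, e2, e3, e4, Nat.cast_zero, zero_sub, sub_zero, eval_choosePoly_natCast,
    eval_choosePoly_natCast, eval_choosePoly_natCast, eval_choosePoly_neg_one,
    eval_choosePoly_neg_one, eval_choosePoly_neg_two, Nat.choose_self, Nat.choose_zero_right,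
    show (v + 3).choose (v + 2) = v + 3 by simp] at key
  rw [show v + 3 - 2 = v + 1 by omega, show v + 3 - 1 = v + 2 by omega]
  have : ((∑ r ∈ Finset.range (v + 1), (-1 : ℤ) ^ r * r.choose a * (v + 3 - 3 - r).choose e *
        (v + 3).choose (r + 1) : ℤ) : ℚ) =
      (((-1) ^ a * (v + 1).choose e + (-1) ^ (v + 3 + e) * ((e + 1) * (v + 2).choose a -
        (v + 3 : ℕ) * (v + 1).choose a) : ℤ) : ℚ) := by
    push_cast at key ⊢
    rw [pow_add _ (v + 3) e]
    linear_combination -key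
  exact_mod_cast this

/-- The auxiliary coefficient `g_{w,d}` is an alternating sum of products of binomial
coefficients. -/
theorem coeffAux_eq_sum {w d a e : ℕ} (hw : 3 ≤ w) (hodd : Odd w) (hd : d = a + e + 1)
    (hdw : d ≤ w) :
    coeffAux w d (a + 1) = (-1) ^ d * ∑ r ∈ Finset.range (w - 2),
      (-1 : ℤ) ^ r * r.choose a * (w - 3 - r).choose e * w.choose (r + 1) := by
  rw [sum_choose_mul_choose_mul_choose' hw (by omega), coeffAux, Nat.add_sub_cancel,
    show d - (a + 1) = e by omega]
  have h1 : (-1 : ℤ) ^ (w + e) = -(-1) ^ e := by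
    rw [pow_add, hodd.neg_one_pow, neg_one_mul]
  -- This relation trades the multiple w of C(w-2, a) for the form used in `coeffAux`.
  have h2 : ((w : ℤ) - 1) * (w - 2).choose a = (w - 1 - a) * (w - 1).choose a := by
    have h := Nat.choose_mul_succ_eq (w - 2) a
    rw [show w - 2 + 1 = w - 1 by omega] at h
    have h' := congrArg (Nat.cast (R := ℤ)) h
    rw [Nat.cast_mul, Nat.cast_mul, Nat.cast_sub (by omega), Nat.cast_sub (by omega)] at h'
    rw [Nat.cast_sub (by omega)] at h'
    push_cast at h'
    linear_combination h'
  have h3 : (-1 : ℤ) ^ d = -((-1) ^ a * (-1) ^ e) := by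
    rw [hd, pow_succ, pow_add]
    ring
  have h4 : (-1 : ℤ) ^ a * (-1) ^ a = 1 := by
    rw [← mul_pow]
    simp
  have h5 : (-1 : ℤ) ^ e * (-1) ^ e = 1 := by
    rw [← mul_pow]
    simp
  have h6 : (d : ℤ) = a + e + 1 := by exact_mod_cast hd
  rw [h1, h3, h6, pow_succ]
  linear_combination (-1) ^ a * h2 - (-1) ^ a * ((e + 1) * ((w - 1).choose a : ℤ) -
    w * (w - 2).choose a) * h5

end Binomial

theorem signedChoose_mul (q r t s : ℕ) :
    signedChoose q r * signedChoose t s =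
      (-1) ^ (q + t + r + s) * ((q.choose r : ℤ) * t.choose s) := by
  rw [signedChoose, signedChoose]
  ring

/-- The weight depends on q only, so the other two binomials convolve into one. For two marked
members the gap between them thereby merges with a tail, which is why the result has the same shape
as for a single exponent at least 3. -/
theorem sum_range_triple_box {w K : ℕ} (hK : w < K) (G : ℕ → ℤ) (a b : ℕ) :
    ∑ q ∈ Finset.range K, ∑ u ∈ Finset.range K, ∑ t ∈ Finset.range K,
        (if q + u + t + 4 = w then G q * ((u.choose a : ℤ) * t.choose b) else 0) =
      ∑ q ∈ Finset.range (w - 2), G q * (w - 3 - q).choose (a + b + 1) := by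
  rw [← sum_subset (range_subset_range.2 (show w - 2 ≤ K by omega))]
  · refine sum_congr rfl fun q hq => ?_
    rw [mem_range] at hq
    have h1 : ∀ u t, (if q + u + t + 4 = w then G q * ((u.choose a : ℤ) * t.choose b) else 0) =
        if u + t + (q + 4) = w then G q * ((u.choose a : ℤ) * t.choose b) else 0 :=
      fun u t => if_congr (by omega) rfl rfl
    simp only [h1]
    rw [sum_range_box hK, ← mul_sum]
    congr 1
    rcases Nat.lt_or_ge w (q + 4) with h | h
    · rw [show w + 1 - (q + 4) = 0 by omega, show w - 3 - q = 0 by omega]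
      simp
    · rw [show w - 3 - q = w - (q + 4) + 1 by omega, ← sum_range_choose_mul_choose,
        show w + 1 - (q + 4) = w - (q + 4) + 1 by omega]
      push_cast
      rfl
  · intro q _ hq
    rw [mem_range] at hq
    exact sum_eq_zero fun u _ => sum_eq_zero fun t _ => if_neg (by omega)

/-! ### Evaluation of the strict sums -/

section Evaluation

open PowerSeries

variable {p : ℕ} [hp : Fact p.Prime]

theorem coeff_chainSum_one {w : ℕ} (hwp : w + 2 < p) (r s : ℕ) (hrs : r + s < w) :
    coeff w (chainSum 0 (List.replicate r (geomTail p 1) ++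
        geomTail p 2 :: List.replicate s (geomTail p 1)) p) =
      ((-1 : ℤ) ^ r * (w - 1).choose r - (-1) ^ s * (w - 1).choose s) • betaMod p w := by
  rw [coeff_chainSum_marked (by omega)]
  have h : ∀ q t, (if q + t + 2 = w then (signedChoose q r * signedChoose t s) •
        powChain (invMod p) 0 (List.replicate q 1 ++ 2 :: List.replicate t 1) p else 0) =
      (if q + t + 2 = w then signedChoose q r * signedChoose t s * ((-1) ^ q * w.choose (q + 1))
        else 0) • betaMod p w := by
    intro q t
    split_ifs with h
    · rw [powChain_two h (by omega), mul_zsmul]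
      simp only [zsmul_eq_mul]
      push_cast
      ring
    · rw [zero_smul]
  simp only [h, ← sum_smul]
  -- For even w both sides vanish with β_w; the comparison of coefficients below needs w odd for its
  -- signs.
  rcases Nat.even_or_odd w with he | ho
  · rw [betaMod_of_even he hwp, smul_zero, smul_zero]
  · congr 1
    rcases Nat.lt_or_ge 1 w with h1 | h1
    · rw [sum_range_box (by omega)]
      have hs : ∀ q ∈ Finset.range (w + 1 - 2), signedChoose q r * signedChoose (w - 2 - q) s *
          ((-1) ^ q * w.choose (q + 1)) = -(-1) ^ (r + s) *
          ((-1 : ℤ) ^ q * q.choose r * (w - 2 - q).choose s * w.choose (q + 1)) := by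
        intro q hq
        rw [mem_range] at hq
        rw [signedChoose_mul, show q + (w - 2 - q) + r + s = (w - 2) + (r + s) by omega, pow_add,
          Odd.neg_one_pow (n := w - 2) (by rw [Nat.odd_iff] at ho ⊢; omega)]
        ring
      rw [sum_congr rfl hs, ← mul_sum, show w + 1 - 2 = w - 1 by omega,
        sum_choose_mul_choose_mul_choose h1 hrs, pow_add, pow_add, ho.neg_one_pow]
      have h4 : (-1 : ℤ) ^ r * (-1) ^ r = 1 := by
        rw [← mul_pow]
        simp
      have h5 : (-1 : ℤ) ^ s * (-1) ^ s = 1 := by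
        rw [← mul_pow]
        simp
      linear_combination -(-1) ^ s * ((w - 1).choose s : ℤ) * h4 +
        (-1) ^ r * ((w - 1).choose r : ℤ) * h5
    -- In weight 1 no exponent can be at least 2, and the coefficient on the right is 1 - 1.
    · have hw : w = 1 := by omega
      have hr : r = 0 := by omega
      have hs : s = 0 := by omega
      subst hw hr hs
      simp

theorem coeff_chainSum_eq_zero_of_even {w : ℕ} (hwp : w + 2 < p) (he : Even w) (r s : ℕ) :
    coeff w (chainSum 0 (List.replicate r (geomTail p 1) ++
        geomTail p 2 :: List.replicate s (geomTail p 1)) p) = 0 := by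
  rw [coeff_chainSum_marked (by omega)]
  refine sum_eq_zero fun q _ => sum_eq_zero fun t _ => ?_
  split_ifs with h
  · rw [powChain_two h (by omega), betaMod_of_even he hwp, mul_zero, smul_zero]
  · rfl

theorem powChain_three {q t w : ℕ} (h : q + t + 3 = w) (hodd : Odd w) (hwp : w + 2 < p) :
    2 * powChain (invMod p) 0 (List.replicate q 1 ++ 3 :: List.replicate t 1) p =
      ((-1) ^ t * (w.choose (t + 1) : ZMod p) - (-1) ^ q * (w.choose (q + 1) : ZMod p)) *
        betaMod p w := by
  rw [← sum_faulhaberMod_mul_powChain_two (q := 0) h hodd hwp,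
    powChain_succ_replicate _ 2 (by omega)]
  simp only [zero_add]

/-- Lowering the second 2 to a 1 fuses the middle block with the tail and leaves single-2 chains, so
the double Bernoulli sum applies with q replaced by u + 1. -/
theorem powChain_two_two {q u t w : ℕ} (h : q + u + t + 4 = w) (hodd : Odd w) (hwp : w + 2 < p) :
    2 * powChain (invMod p) 0 (List.replicate q 1 ++ 2 :: (List.replicate u 1 ++
        2 :: List.replicate t 1)) p =
      ((-1) ^ t * (w.choose (t + 1) : ZMod p) - (-1) ^ q * (w.choose (q + 1) : ZMod p)) *
        betaMod p w := by
  rw [← sum_faulhaberMod_mul_powChain_two (a := q) (q := u + 1) (k := t) (by omega) hodd hwp]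
  have h1 := powChain_succ_replicate (p := p) (List.replicate q 1 ++ 2 :: List.replicate u 1) 1
    (k := t) (by omega)
  simp only [List.append_assoc, List.cons_append, one_add_one_eq_two] at h1
  rw [h1]
  congr 1
  refine sum_congr rfl fun v _ => ?_
  rw [← List.replicate_succ, List.replicate_append_replicate,
    show u + (v + 1) = u + 1 + v by omega]

theorem two_mul_coeff_chainSum_three {w d : ℕ} (hwp : w + 2 < p) (hodd : Odd w) (r s : ℕ)
    (hd : d = r + s + 1) (hdw : d ≤ w) :
    2 * coeff w (chainSum 0 (List.replicate r (geomTail p 1) ++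
        geomTail p 3 :: List.replicate s (geomTail p 1)) p) =
      (coeffAux w d (r + 1) - coeffAux w d (s + 1)) • betaMod p w := by
  rw [coeff_chainSum_marked (by omega)]
  have h : ∀ q t, 2 * (if q + t + 3 = w then (signedChoose q r * signedChoose t s) •
        powChain (invMod p) 0 (List.replicate q 1 ++ 3 :: List.replicate t 1) p else 0) =
      ((if q + t + 3 = w then
          signedChoose q r * signedChoose t s * ((-1) ^ t * w.choose (t + 1)) else 0) -
        (if q + t + 3 = w then
          signedChoose q r * signedChoose t s * ((-1) ^ q * w.choose (q + 1)) else 0)) •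
        betaMod p w := by
    intro q t
    split_ifs with h
    · rw [mul_smul_comm, powChain_three h hodd hwp]
      simp only [zsmul_eq_mul]
      push_cast
      ring
    · simp
  simp only [mul_sum, h, ← sum_smul, sum_sub_distrib]
  congr 1
  rcases Nat.lt_or_ge 2 w with h1 | h1
  -- Exchanging q and t turns the first half of `powChain_three` into the second with r and s
  -- exchanged, so one evaluation covers both.
  · have key : ∀ a e : ℕ, d = a + e + 1 →
        ∑ q ∈ Finset.range (p + 1), ∑ t ∈ Finset.range (p + 1), (if q + t + 3 = w then
          signedChoose q a * signedChoose t e * ((-1) ^ q * w.choose (q + 1)) else 0) =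
        -coeffAux w d (a + 1) := by
      intro a e hae
      rw [sum_range_box (by omega), coeffAux_eq_sum h1 hodd hae hdw, mul_sum, ← sum_neg_distrib,
        show w + 1 - 3 = w - 2 by omega]
      refine sum_congr rfl fun q hq => ?_
      rw [mem_range] at hq
      rw [signedChoose_mul, show q + (w - 3 - q) + a + e = w - 3 + (a + e) by omega, hae, pow_add,
        Even.neg_one_pow (n := w - 3) (by rw [Nat.odd_iff] at hodd; rw [Nat.even_iff]; omega),
        pow_succ]
      ring
    rw [key r s hd, sum_comm]
    have h2 := key s r (by omega)
    rw [sub_neg_eq_add, add_comm, sub_eq_add_neg, ← h2]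
    congr 1
    refine sum_congr rfl fun t _ => sum_congr rfl fun q _ => ?_
    rw [add_comm q t, mul_comm (signedChoose q r)]
  · have hw : w = 1 := by
      rw [Nat.odd_iff] at hodd
      omega
    have hr : r = 0 := by omega
    have hs : s = 0 := by omega
    subst hw hr hs
    simp

theorem two_mul_coeff_chainSum_two_two {w d : ℕ} (hwp : w + 2 < p) (hodd : Odd w) (r g s : ℕ)
    (hd : d = r + g + s + 2) (hdw : d ≤ w) :
    2 * coeff w (chainSum 0 (List.replicate r (geomTail p 1) ++ geomTail p 2 ::
        (List.replicate g (geomTail p 1) ++ geomTail p 2 :: List.replicate s (geomTail p 1))) p) =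
      (coeffAux w d (r + 1) - coeffAux w d (s + 1)) • betaMod p w := by
  rw [coeff_chainSum_marked₂ (by omega)]
  have h : ∀ q u t, 2 * (if q + u + t + 2 * 2 = w then
        (signedChoose q r * signedChoose u g * signedChoose t s) •
          powChain (invMod p) 0 (List.replicate q 1 ++ 2 ::
            (List.replicate u 1 ++ 2 :: List.replicate t 1)) p else 0) =
      ((if q + u + t + 4 = w then
          (-1 : ℤ) ^ (d + 1) * ((q.choose r : ℤ) * u.choose g * t.choose s) *
          ((-1) ^ t * w.choose (t + 1)) else 0) -
        (if q + u + t + 4 = w then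
          (-1 : ℤ) ^ (d + 1) * ((q.choose r : ℤ) * u.choose g * t.choose s) *
          ((-1) ^ q * w.choose (q + 1)) else 0)) • betaMod p w := by
    intro q u t
    by_cases h : q + u + t + 4 = w
    · have hsign : signedChoose q r * signedChoose u g * signedChoose t s =
          (-1) ^ (d + 1) * ((q.choose r : ℤ) * u.choose g * t.choose s) := by
        rw [signedChoose_mul, signedChoose, neg_one_pow_congr (a := d + 1)
          (b := q + u + r + g + (t + s)) (by rw [Nat.odd_iff] at hodd; rw [Nat.even_iff]; omega)]
        ring
      rw [if_pos (by omega), if_pos h, if_pos h, hsign, mul_smul_comm, powChain_two_two h hodd hwp]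
      simp only [zsmul_eq_mul]
      push_cast
      ring
    · rw [if_neg (by omega), if_neg h, if_neg h]
      simp
  simp only [mul_sum, h, ← sum_smul, sum_sub_distrib]
  congr 1
  -- Again the two halves differ only by exchanging head and tail; the middle block and the far end
  -- together count as e = g + b + 1 unmarked members.
  have key : ∀ a b : ℕ, d = a + (g + b + 1) + 1 →
      ∑ q ∈ Finset.range (p + 1), ∑ u ∈ Finset.range (p + 1), ∑ t ∈ Finset.range (p + 1),
        (if q + u + t + 4 = w then
          (-1 : ℤ) ^ (d + 1) * ((q.choose a : ℤ) * u.choose g * t.choose b) *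
            ((-1) ^ q * w.choose (q + 1)) else 0) =
      -coeffAux w d (a + 1) := by
    intro a b hab
    rw [coeffAux_eq_sum (by rw [Nat.odd_iff] at hodd; omega) hodd hab hdw, ← neg_mul,
      ← neg_one_mul ((-1 : ℤ) ^ d), ← pow_succ', mul_sum]
    have h2 := sum_range_triple_box (w := w) (K := p + 1) (by omega)
      (fun q => (-1 : ℤ) ^ (d + 1) * (q.choose a * ((-1) ^ q * w.choose (q + 1)))) g b
    refine Eq.trans ?_ (h2.trans ?_)
    · refine sum_congr rfl fun q _ => sum_congr rfl fun u _ => sum_congr rfl fun t _ => ?_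
      split_ifs
      · ring
      · rfl
    · exact sum_congr rfl fun q _ => by ring
  rw [key r s (by omega)]
  have h2 := key s r (by omega)
  rw [sub_neg_eq_add, add_comm, sub_eq_add_neg, ← h2]
  refine congrArg (fun x => coeffAux w d (r + 1) + x) ?_
  calc _ = ∑ q ∈ Finset.range (p + 1), ∑ t ∈ Finset.range (p + 1), ∑ u ∈ Finset.range (p + 1),
        (if q + u + t + 4 = w then
          (-1 : ℤ) ^ (d + 1) * ((q.choose r : ℤ) * u.choose g * t.choose s) *
            ((-1) ^ t * w.choose (t + 1)) else 0) := sum_congr rfl fun q _ => sum_comm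
    _ = _ := by
      rw [sum_comm]
      refine sum_congr rfl fun t _ => ?_
      rw [sum_comm]
      refine sum_congr rfl fun u _ => sum_congr rfl fun q _ => ?_
      rw [show q + u + t = t + u + q by omega]
      split_ifs
      · ring
      · rfl

end Evaluation

/-! ### The antipode when unmarked chain sums vanish -/

section Antipode

variable {R S : Type*} [CommRing R] [CommRing S] (φ : R →+* S) {f : ℕ → R} {N : ℕ}

/-- As long as the first list contains only `f`, each product term is killed by φ, so moving a
further `f` across merely changes the sign. -/
theorem map_altSum_replicate_left (h0 : ∀ r, r ≠ 0 → φ (chainSum 0 (List.replicate r f) N) = 0)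
    {a : ℕ} (ha : a ≠ 0) (b : ℕ) (L : List (ℕ → R)) :
    φ (altSum N (List.replicate a f) (List.replicate b f ++ L)) =
      (-1) ^ b * φ (altSum N (List.replicate (a + b) f) L) := by
  induction b generalizing a with
  | zero => simp
  | succ b ih =>
    rw [List.replicate_succ, List.cons_append, altSum, map_sub, map_mul, h0 a ha, zero_mul,
      ← List.replicate_succ, ih (Nat.succ_ne_zero a), show a + 1 + b = a + (b + 1) by omega]
    ring

theorem map_chainSumStar_replicate (h0 : ∀ r, r ≠ 0 → φ (chainSum 0 (List.replicate r f) N) = 0)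
    {b : ℕ} (hb : b ≠ 0) : φ (chainSumStar (List.replicate b f) N) = 0 := by
  obtain ⟨b, rfl⟩ := Nat.exists_eq_succ_of_ne_zero hb
  have h1 := congrArg φ (altSum_nil_left N f (List.replicate b f))
  have h2 := map_altSum_replicate_left φ h0 one_ne_zero b []
  rw [List.append_nil, altSum, h0 _ (by omega), mul_zero] at h2
  rw [altSum, chainSum_nil, one_mul, map_sub, map_zero] at h1
  rw [Nat.succ_eq_add_one, List.replicate_succ]
  exact (sub_eq_zero.1 h1).trans h2

theorem map_chainSumStar_append_cons
    (h0 : ∀ r, r ≠ 0 → φ (chainSum 0 (List.replicate r f) N) = 0)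
    (b : ℕ) (g : ℕ → R) (L : List (ℕ → R)) :
    φ (chainSumStar (List.replicate b f ++ g :: L) N) =
      (-1) ^ b * φ (altSum N (g :: List.replicate b f) L) := by
  cases b with
  | zero =>
    have h1 := congrArg φ (altSum_nil_left N g L)
    rw [altSum, chainSum_nil, one_mul, map_sub, map_zero, sub_eq_zero] at h1
    simpa using h1
  | succ b =>
    have h1 := congrArg φ (altSum_nil_left N f (List.replicate b f ++ g :: L))
    rw [altSum, chainSum_nil, one_mul, map_sub, map_zero, sub_eq_zero] at h1
    have h2 := map_altSum_replicate_left φ h0 one_ne_zero b (g :: L)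
    rw [altSum, map_sub, map_mul, h0 _ (by omega), zero_mul, add_comm 1 b] at h2
    rw [List.replicate_succ, List.cons_append, h1]
    refine h2.trans ?_
    rw [List.replicate_succ]
    ring

/-- Here the weak factors are unmarked and die under φ; only the final strict chain remains. -/
theorem map_altSum_replicate_right (h0 : ∀ r, r ≠ 0 → φ (chainSum 0 (List.replicate r f) N) = 0)
    (A : List (ℕ → R)) (b : ℕ) :
    φ (altSum N A (List.replicate b f)) =
      (-1) ^ b * φ (chainSum 0 (List.replicate b f ++ A) N) := by
  induction b generalizing A with
  | zero => simp [altSum]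
  | succ b ih =>
    rw [List.replicate_succ, altSum, map_sub, map_mul, ← List.replicate_succ,
      map_chainSumStar_replicate φ h0 (Nat.succ_ne_zero b), mul_zero, ih, List.replicate_succ',
      List.append_assoc, List.singleton_append]
    ring

theorem map_chainSumStar_one (h0 : ∀ r, r ≠ 0 → φ (chainSum 0 (List.replicate r f) N) = 0)
    (b : ℕ) (g : ℕ → R) (e : ℕ) :
    φ (chainSumStar (List.replicate b f ++ g :: List.replicate e f) N) =
      (-1) ^ (b + e) * φ (chainSum 0 (List.replicate e f ++ g :: List.replicate b f) N) := by
  rw [map_chainSumStar_append_cons φ h0, map_altSum_replicate_right φ h0, pow_add, mul_assoc]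

end Antipode

/-! ### Star sums, and the passage from indices to series -/

section Star

open PowerSeries

variable {p : ℕ} [hp : Fact p.Prime]

/-- Truncation of power series at `X ^ (p - 1)`. -/
noncomputable def truncHom (p : ℕ) [Fact p.Prime] :
    (ZMod p)⟦X⟧ →+* (ZMod p)⟦X⟧ ⧸ Ideal.span {(X : (ZMod p)⟦X⟧) ^ (p - 1)} :=
  Ideal.Quotient.mk _

theorem coeff_eq_of_truncHom_eq {A B : (ZMod p)⟦X⟧} (h : truncHom p A = truncHom p B) {w : ℕ}
    (hw : w < p - 1) : coeff w A = coeff w B := by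
  rw [truncHom, Ideal.Quotient.eq, Ideal.mem_span_singleton, X_pow_dvd_iff] at h
  have := h w hw
  rwa [map_sub, sub_eq_zero] at this

theorem truncHom_chainSum_replicate (r : ℕ) (hr : r ≠ 0) :
    truncHom p (chainSum 0 (List.replicate r (geomTail p 1)) p) = 0 := by
  rw [truncHom, Ideal.Quotient.eq_zero_iff_mem, Ideal.mem_span_singleton]
  exact X_pow_dvd_chainSum_replicate hr

theorem coeff_neg_one_pow_mul (w n : ℕ) (A : (ZMod p)⟦X⟧) :
    coeff w ((-1) ^ n * A) = (-1) ^ n * coeff w A := by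
  have : ((-1 : (ZMod p)⟦X⟧)) ^ n = C ((-1) ^ n) := by simp
  rw [this, coeff_C_mul]

theorem coeff_chainSumStar_one {w : ℕ} (hw : w < p - 1) (r s : ℕ) (g : ℕ → (ZMod p)⟦X⟧) :
    coeff w (chainSumStar (List.replicate r (geomTail p 1) ++
        g :: List.replicate s (geomTail p 1)) p) =
      (-1) ^ (r + s) * coeff w (chainSum 0 (List.replicate s (geomTail p 1) ++
        g :: List.replicate r (geomTail p 1)) p) := by
  rw [← coeff_neg_one_pow_mul]
  refine coeff_eq_of_truncHom_eq ?_ hw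
  rw [map_chainSumStar_one _ truncHom_chainSum_replicate]
  simp

/-- In odd weight the products of two chain sums with one marked member vanish. -/
theorem coeff_altSum_two {w : ℕ} (hwp : w + 2 < p) (hodd : Odd w) (a b c e : ℕ) :
    coeff w (altSum p (List.replicate a (geomTail p 1) ++ geomTail p 2 ::
        List.replicate b (geomTail p 1)) (List.replicate c (geomTail p 1) ++ geomTail p 2 ::
        List.replicate e (geomTail p 1))) =
      (-1) ^ (c + 1 + e) * coeff w (chainSum 0 (List.replicate e (geomTail p 1) ++ geomTail p 2 ::
        (List.replicate (a + c) (geomTail p 1) ++ geomTail p 2 ::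
          List.replicate b (geomTail p 1))) p) := by
  -- The weights of the two factors add up to the odd number w, so one is even and its singly marked
  -- sum vanishes; the star factor is first reversed into a strict one.
  have hprod : ∀ a b c e, coeff w (chainSum 0 (List.replicate a (geomTail p 1) ++ geomTail p 2 ::
      List.replicate b (geomTail p 1)) p * chainSumStar (List.replicate c (geomTail p 1) ++
        geomTail p 2 :: List.replicate e (geomTail p 1)) p) = 0 := by
    intro a b c e
    rw [coeff_mul]
    refine sum_eq_zero fun x hx => ?_
    rw [HasAntidiagonal.mem_antidiagonal] at hx
    rcases Nat.even_or_odd x.1 with h | h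
    · rw [coeff_chainSum_eq_zero_of_even (by omega) h, zero_mul]
    · have he : Even x.2 := by
        rw [Nat.odd_iff] at h hodd
        rw [Nat.even_iff]
        omega
      rw [coeff_chainSumStar_one (by omega),
        coeff_chainSum_eq_zero_of_even (w := x.2) (by omega) he, mul_zero, mul_zero]
  induction c generalizing a with
  | zero =>
    have h1 := hprod a b 0 e
    rw [List.replicate_zero, List.nil_append] at h1 ⊢
    rw [altSum, map_sub, h1, zero_sub, add_zero]
    have h2 := coeff_eq_of_truncHom_eq (A := altSum p (geomTail p 2 ::
        (List.replicate a (geomTail p 1) ++ geomTail p 2 :: List.replicate b (geomTail p 1)))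
        (List.replicate e (geomTail p 1)))
      (B := (-1) ^ e * chainSum 0 (List.replicate e (geomTail p 1) ++ geomTail p 2 ::
        (List.replicate a (geomTail p 1) ++ geomTail p 2 :: List.replicate b (geomTail p 1))) p)
      (by rw [map_altSum_replicate_right _ truncHom_chainSum_replicate]; simp)
      (show w < p - 1 by omega)
    rw [h2, coeff_neg_one_pow_mul]
    ring
  | succ c ih =>
    have h1 := hprod a b (c + 1) e
    rw [List.replicate_succ, List.cons_append] at h1 ⊢
    rw [altSum, map_sub, h1, zero_sub, ← List.cons_append, ← List.replicate_succ, ih,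
      show a + 1 + c = a + (c + 1) by omega]
    ring

theorem coeff_chainSumStar_two {w : ℕ} (hwp : w + 2 < p) (hodd : Odd w) (r g s : ℕ) :
    coeff w (chainSumStar (List.replicate r (geomTail p 1) ++ geomTail p 2 ::
        (List.replicate g (geomTail p 1) ++ geomTail p 2 :: List.replicate s (geomTail p 1))) p) =
      -(-1) ^ (r + g + s) * coeff w (chainSum 0 (List.replicate s (geomTail p 1) ++ geomTail p 2 ::
        (List.replicate g (geomTail p 1) ++ geomTail p 2 ::
          List.replicate r (geomTail p 1))) p) := by
  have h := coeff_altSum_two hwp hodd 0 r g s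
  rw [List.replicate_zero, List.nil_append, zero_add] at h
  have h2 := coeff_eq_of_truncHom_eq (A := chainSumStar (List.replicate r (geomTail p 1) ++
      geomTail p 2 :: (List.replicate g (geomTail p 1) ++ geomTail p 2 ::
        List.replicate s (geomTail p 1))) p)
    (B := (-1) ^ r * altSum p (geomTail p 2 :: List.replicate r (geomTail p 1))
      (List.replicate g (geomTail p 1) ++ geomTail p 2 :: List.replicate s (geomTail p 1)))
    (by rw [map_chainSumStar_append_cons _ truncHom_chainSum_replicate]; simp)
    (show w < p - 1 by omega)
  rw [h2, coeff_neg_one_pow_mul, h]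
  ring

theorem coeff_chainSum_replicate {w d : ℕ} (hw : w < p - 1) (hd : d ≠ 0) :
    coeff w (chainSum 0 (List.replicate d (geomTail p 1)) p) = 0 ∧
      coeff w (chainSumStar (List.replicate d (geomTail p 1)) p) = 0 := by
  constructor
  · rw [← map_zero (coeff (R := ZMod p) w)]
    exact coeff_eq_of_truncHom_eq (by rw [truncHom_chainSum_replicate d hd, map_zero]) hw
  · rw [← map_zero (coeff (R := ZMod p) w)]
    exact coeff_eq_of_truncHom_eq
      (by rw [map_chainSumStar_replicate _ truncHom_chainSum_replicate hd, map_zero]) hw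

theorem two_mul_cancel_of_prime {x y : ZMod p} (hp2 : 2 < p) (h : 2 * x = 2 * y) : x = y := by
  have h2 : (2 : ZMod p) ≠ 0 := by
    exact_mod_cast natCast_ne_zero_of_lt (p := p) (n := 2) (by omega) hp2
  exact mul_left_cancel₀ h2 h

/-- The star sum is, up to sign, the strict sum of the reversed chain, and reversal negates the
strict value because its coefficient is antisymmetric in r and s. The case of two marked members is
analogous. -/
theorem coeff_chainSum_three_eq_star {w d : ℕ} (hwp : w + 2 < p) (hodd : Odd w) (r s : ℕ)
    (hd : d = r + s + 1) (hdw : d ≤ w) :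
    coeff w (chainSum 0 (List.replicate r (geomTail p 1) ++
        geomTail p 3 :: List.replicate s (geomTail p 1)) p) =
      (-1) ^ d * coeff w (chainSumStar (List.replicate r (geomTail p 1) ++
        geomTail p 3 :: List.replicate s (geomTail p 1)) p) := by
  refine two_mul_cancel_of_prime (by omega) ?_
  have h1 := two_mul_coeff_chainSum_three hwp hodd r s hd hdw
  have h2 := two_mul_coeff_chainSum_three hwp hodd s r (by omega) hdw
  have h3 : (-1 : ZMod p) ^ d * (-1) ^ (r + s) = -1 := by
    rw [← pow_add, hd]
    exact Odd.neg_one_pow ⟨r + s, by omega⟩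
  rw [← neg_sub, neg_smul] at h2
  rw [coeff_chainSumStar_one (by omega)]
  linear_combination h1 + h2 - 2 * coeff w (chainSum 0 (List.replicate s (geomTail p 1) ++
    geomTail p 3 :: List.replicate r (geomTail p 1)) p) * h3

theorem coeff_chainSum_two_two_eq_star {w d : ℕ} (hwp : w + 2 < p) (hodd : Odd w) (r g s : ℕ)
    (hd : d = r + g + s + 2) (hdw : d ≤ w) :
    coeff w (chainSum 0 (List.replicate r (geomTail p 1) ++ geomTail p 2 ::
        (List.replicate g (geomTail p 1) ++ geomTail p 2 :: List.replicate s (geomTail p 1))) p) =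
      (-1) ^ d * coeff w (chainSumStar (List.replicate r (geomTail p 1) ++ geomTail p 2 ::
        (List.replicate g (geomTail p 1) ++ geomTail p 2 ::
          List.replicate s (geomTail p 1))) p) := by
  refine two_mul_cancel_of_prime (by omega) ?_
  have h1 := two_mul_coeff_chainSum_two_two hwp hodd r g s hd hdw
  have h2 := two_mul_coeff_chainSum_two_two hwp hodd s g r (by omega) hdw
  have h3 : (-1 : ZMod p) ^ d * (-1) ^ (r + g + s) = 1 := by
    rw [← pow_add, hd]
    exact Even.neg_one_pow ⟨r + g + s + 1, by omega⟩
  rw [← neg_sub, neg_smul] at h2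
  rw [coeff_chainSumStar_two hwp hodd]
  linear_combination h1 + h2 + 2 * coeff w (chainSum 0 (List.replicate s (geomTail p 1) ++
    geomTail p 2 :: (List.replicate g (geomTail p 1) ++ geomTail p 2 ::
      List.replicate r (geomTail p 1))) p) * h3

/-- Summation over the signs removes the parity conditions, and summation over the exponents turns
the sum into a coefficient of a chain sum of power series. -/
theorem sum_indices_eq_coeff (w : ℕ) {d : ℕ} (e : Fin d → ℕ) (he : ∀ j, 1 ≤ e j)
    (A : Finset (Fin d → ℕ)) :
    ∑ s ∈ indices w d with ∀ j, e j ≤ (s j).natAbs,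
        ∑ n ∈ A with ∀ j, (0 < s j ↔ Even (n j)), ∏ j, ((n j : ZMod p) ^ (s j).natAbs)⁻¹ =
      coeff w (∑ n ∈ A, ∏ j, geomTail p (e j) (n j)) := by
  classical
  rw [map_sum]
  simp only [sum_filter (s := A)]
  rw [sum_comm]
  refine sum_congr rfl fun n _ => ?_
  rw [coeff_prod]
  simp only [geomTail, coeff_mk, prod_ite_zero, mem_univ, true_imp_iff]
  rw [← sum_filter, ← sum_filter, filter_filter]
  -- For fixed n, the exponents determine s: the parity of `n j` prescribes the sign of `s j`.
  refine sum_bij' (fun s _ => Finsupp.equivFunOnFinite.symm fun j => (s j).natAbs)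
    (fun l _ j => if Even (n j) then (l j : ℤ) else -(l j : ℤ)) ?_ ?_ ?_ ?_ ?_
  · intro s hs
    simp only [indices, mem_filter, mem_finsuppAntidiag] at hs ⊢
    exact ⟨⟨by simpa using hs.1.2.2, by simp⟩, by simpa using hs.2.1⟩
  · intro l hl
    simp only [indices, mem_filter, mem_finsuppAntidiag, Fintype.mem_piFinset, mem_Icc] at hl ⊢
    have hpos : ∀ j, 0 < l j := fun j => (he j).trans (hl.2 j)
    have habs : ∀ j, (if Even (n j) then (l j : ℤ) else -(l j : ℤ)).natAbs = l j := by
      intro j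
      split_ifs <;> simp
    have hle : ∀ j, l j ≤ w := fun j => by
      rw [← hl.1.1]
      exact single_le_sum (f := l) (fun _ _ => Nat.zero_le _) (mem_univ j)
    simp only [habs]
    refine ⟨⟨fun j => ?_, fun j => ?_, hl.1.1⟩, hl.2, fun j => ?_⟩
    · have := hle j
      split_ifs <;> omega
    · have := hpos j
      split_ifs <;> omega
    · have := hpos j
      split_ifs with h
      · simp [h, this]
      · simp [h]
  · intro s hs
    simp only [mem_filter] at hs
    funext j
    have h := hs.2.2 j
    simp only [Finsupp.coe_equivFunOnFinite_symm]
    by_cases h' : Even (n j)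
    · have := h.2 h'
      rw [if_pos h']
      omega
    · have : ¬ 0 < s j := fun hc => h' (h.1 hc)
      rw [if_neg h']
      omega
  · intro l hl
    ext j
    simp only [Finsupp.coe_equivFunOnFinite_symm]
    split_ifs <;> simp
  · intro s hs
    simp [invMod]

end Star

/-! ### Transfer to the ring 𝒜 -/

theorem ofFn_ite_eq {α : Type*} {d : ℕ} (a b : α) (i : Fin d) :
    List.ofFn (fun l => if l = i then b else a) =
      List.replicate i a ++ b :: List.replicate (d - (i + 1)) a := by
  have hi := i.2
  refine List.ext_getElem (by simp; omega) fun n h1 h2 => ?_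
  simp only [List.getElem_ofFn, List.getElem_append, List.length_replicate, List.getElem_replicate,
    List.getElem_cons, Fin.ext_iff]
  split_ifs <;> first | rfl | omega

theorem ofFn_ite_or_eq {α : Type*} {d : ℕ} (a b : α) {i j : Fin d} (h : j < i) :
    List.ofFn (fun l => if l = i ∨ l = j then b else a) =
      List.replicate j a ++ b :: (List.replicate (i - (j + 1)) a ++
        b :: List.replicate (d - (i + 1)) a) := by
  have hi := i.2
  rw [Fin.lt_def] at h
  refine List.ext_getElem (by simp; omega) fun n h1 h2 => ?_
  simp only [List.getElem_ofFn, List.getElem_append, List.length_replicate, List.getElem_replicate,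
    List.getElem_cons, Fin.ext_iff]
  split_ifs <;> first | rfl | omega

open PowerSeries

theorem mk_eq_mk_of_forall_lt {f g : (p : {p : ℕ // p.Prime}) → ZMod (p : ℕ)} (B : ℕ)
    (h : ∀ p : {p : ℕ // p.Prime}, B < (p : ℕ) → f p = g p) :
    PrimeAdele.mk f = PrimeAdele.mk g := by
  refine PrimeAdele.mk_eq_mk.2 (Set.Finite.of_finite_image (f := fun p : {p : ℕ // p.Prime} =>
    (p : ℕ)) ((Set.finite_le_nat B).subset ?_) (fun a _ b _ h => Subtype.ext h))
  rintro _ ⟨p, hp, rfl⟩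
  by_contra hB
  exact hp (h p (not_le.1 hB))

theorem sum_M_eq_mk (w : ℕ) {d : ℕ} (e : Fin d → ℕ) (he : ∀ j, 1 ≤ e j) :
    ∑ s ∈ indices w d with ∀ j, e j ≤ (s j).natAbs, M s =
      PrimeAdele.mk fun p =>
        coeff w (chainSum 0 (List.ofFn fun j => geomTail (p : ℕ) (e j)) (p : ℕ)) := by
  simp only [M]
  rw [← map_sum]
  congr 1
  funext p
  rw [Finset.sum_apply, ← sum_strictAnti_eq_chainSum, ← sum_indices_eq_coeff w e he]
  refine sum_congr rfl fun s _ => ?_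
  rw [range, filter_filter]

theorem sum_MStar_eq_mk (w : ℕ) {d : ℕ} (e : Fin d → ℕ) (he : ∀ j, 1 ≤ e j) :
    ∑ s ∈ indices w d with ∀ j, e j ≤ (s j).natAbs, MStar s =
      PrimeAdele.mk fun p =>
        coeff w (chainSumStar (List.ofFn fun j => geomTail (p : ℕ) (e j)) (p : ℕ)) := by
  simp only [MStar]
  rw [← map_sum]
  congr 1
  funext p
  rw [Finset.sum_apply, ← sum_antitone_eq_chainSumStar, ← sum_indices_eq_coeff w e he]
  refine sum_congr rfl fun s _ => ?_
  rw [rangeStar, filter_filter]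

theorem indices_eq_filter (w d : ℕ) :
    indices w d = {s ∈ indices w d | ∀ j, 1 ≤ (s j).natAbs} := by
  refine (filter_true_of_mem fun s hs j => ?_).symm
  simp only [indices, mem_filter] at hs
  exact Int.natAbs_pos.2 (hs.2.1 j)

theorem indices₁_eq_filter (w : ℕ) {d : ℕ} (i : Fin d) :
    indices₁ w i = {s ∈ indices w d | ∀ j, (if j = i then 2 else 1) ≤ (s j).natAbs} := by
  refine filter_congr fun s hs => ?_
  simp only [indices, mem_filter] at hs
  refine ⟨fun h j => ?_, fun h => by simpa using h i⟩
  split_ifs with hj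
  · rwa [hj]
  · exact Int.natAbs_pos.2 (hs.2.1 j)

theorem indices₂_self_eq_filter (w : ℕ) {d : ℕ} (i : Fin d) :
    indices₂ w i i = {s ∈ indices w d | ∀ j, (if j = i then 3 else 1) ≤ (s j).natAbs} := by
  refine filter_congr fun s hs => ?_
  simp only [indices, mem_filter] at hs
  rw [if_pos rfl]
  refine ⟨fun h j => ?_, fun h => by simpa using h i⟩
  split_ifs with hj
  · rwa [hj]
  · exact Int.natAbs_pos.2 (hs.2.1 j)

theorem indices₂_eq_filter (w : ℕ) {d : ℕ} {i j : Fin d} (hij : j < i) :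
    indices₂ w i j =
      {s ∈ indices w d | ∀ l, (if l = i ∨ l = j then 2 else 1) ≤ (s l).natAbs} := by
  refine filter_congr fun s hs => ?_
  simp only [indices, mem_filter] at hs
  rw [if_neg hij.ne']
  refine ⟨fun h l => ?_, fun h => ⟨by simpa using h i, by simpa using h j⟩⟩
  split_ifs with hl
  · rcases hl with rfl | rfl
    · exact h.1
    · exact h.2
  · exact Int.natAbs_pos.2 (hs.2.1 l)

theorem ofFn_geomTail_ite (p : ℕ) [Fact p.Prime] {d : ℕ} (P : Fin d → Prop) [DecidablePred P]
    (c : ℕ) : (List.ofFn fun j => geomTail p (if P j then c else 1)) =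
      List.ofFn fun j => if P j then geomTail p c else geomTail p 1 := by
  congr 1
  funext j
  split_ifs <;> rfl

/-- `bernoulli` and `bernoulli'` differ only at index 1, and p - w = 1 is excluded by p > w + 1. -/
theorem zsmul_beta_eq_mk (w : ℕ) (c : ℤ) :
    c • beta w = PrimeAdele.mk fun p => c • betaMod (p : ℕ) w := by
  rw [beta, ← map_zsmul]
  refine mk_eq_mk_of_forall_lt (w + 1) fun p hp => ?_
  rw [Pi.smul_apply, if_pos (by omega), betaMod, bernoulli_eq_bernoulli'_of_ne_one (by omega)]

theorem sum_indices_eq_zero {w d : ℕ} (hd : 1 ≤ d) :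
    ∑ s ∈ indices w d, M s = 0 ∧ ∑ s ∈ indices w d, MStar s = 0 := by
  have h : ∀ p : {p : ℕ // p.Prime}, w + 2 < (p : ℕ) → _ := fun p hp =>
    coeff_chainSum_replicate (p := p) (w := w) (d := d) (by omega) (by omega)
  rw [indices_eq_filter, sum_M_eq_mk w (fun _ => 1) (fun _ => le_rfl),
    sum_MStar_eq_mk w (fun _ => 1) (fun _ => le_rfl), ← map_zero PrimeAdele.mk]
  refine ⟨mk_eq_mk_of_forall_lt (w + 2) fun p hp => ?_,
    mk_eq_mk_of_forall_lt (w + 2) fun p hp => ?_⟩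
  · rw [List.ofFn_const, (h p hp).1, Pi.zero_apply]
  · rw [List.ofFn_const, (h p hp).2, Pi.zero_apply]

theorem sum_indices₁_M {w d : ℕ} (hdw : d ≤ w) (i : Fin d) :
    ∑ s ∈ indices₁ w i, M s = ((-1 : ℤ) ^ (i : ℕ) * (((w - 1).choose (i : ℕ) : ℤ) +
      (-1) ^ d * ((w - 1).choose (d - ((i : ℕ) + 1)) : ℤ))) • beta w := by
  have hi := i.2
  rw [indices₁_eq_filter, sum_M_eq_mk w _ (fun j => by split_ifs <;> omega), zsmul_beta_eq_mk]
  refine mk_eq_mk_of_forall_lt (w + 2) fun p hp => ?_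
  rw [ofFn_geomTail_ite, ofFn_ite_eq, coeff_chainSum_one hp _ _ (by omega)]
  congr 1
  have h : (-1 : ℤ) ^ (i : ℕ) * (-1) ^ d = -(-1) ^ (d - ((i : ℕ) + 1)) := by
    rw [← pow_add, ← neg_one_mul ((-1 : ℤ) ^ (d - ((i : ℕ) + 1))), ← pow_succ']
    exact neg_one_pow_congr ⟨d, by omega⟩
  linear_combination -((w - 1).choose (d - ((i : ℕ) + 1)) : ℤ) * h

theorem sum_indices₁_MStar {w d : ℕ} (hdw : d ≤ w) (i : Fin d) :
    ∑ s ∈ indices₁ w i, MStar s = ((-1 : ℤ) ^ (i : ℕ) * ((-1) ^ d * ((w - 1).choose (i : ℕ) : ℤ) +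
      ((w - 1).choose (d - ((i : ℕ) + 1)) : ℤ))) • beta w := by
  have hi := i.2
  rw [indices₁_eq_filter, sum_MStar_eq_mk w _ (fun j => by split_ifs <;> omega), zsmul_beta_eq_mk]
  refine mk_eq_mk_of_forall_lt (w + 2) fun p hp => ?_
  rw [ofFn_geomTail_ite, ofFn_ite_eq, coeff_chainSumStar_one (by omega),
    coeff_chainSum_one hp _ _ (by omega)]
  have h1 : (-1 : ZMod p) ^ ((i : ℕ) + (d - ((i : ℕ) + 1))) * (-1) ^ (d - ((i : ℕ) + 1)) =
      (-1) ^ (i : ℕ) := by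
    rw [← pow_add]
    exact neg_one_pow_congr ⟨d - 1, by omega⟩
  have h2 : (-1 : ZMod p) ^ ((i : ℕ) + (d - ((i : ℕ) + 1))) * (-1) ^ (i : ℕ) =
      -((-1) ^ (i : ℕ) * (-1) ^ d) := by
    rw [← pow_add, ← pow_add, ← neg_one_mul ((-1 : ZMod p) ^ ((i : ℕ) + d)), ← pow_succ']
    exact neg_one_pow_congr ⟨d + (i : ℕ), by omega⟩
  simp only [zsmul_eq_mul]
  push_cast
  linear_combination betaMod (p : ℕ) w * ((w - 1).choose (d - ((i : ℕ) + 1)) : ZMod p) * h1 -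
    betaMod (p : ℕ) w * ((w - 1).choose (i : ℕ) : ZMod p) * h2

/-- The factor 2 stays on the left so that only integer multiples occur; it is divided out at the
end in the `ℚ`-algebra. -/
theorem sum_indices₂ {w d : ℕ} (hdw : d ≤ w) (hodd : Odd w) {i j : Fin d} (hij : j ≤ i) :
    ∑ s ∈ indices₂ w i j, M s = (-1 : ℤ) ^ d • ∑ s ∈ indices₂ w i j, MStar s ∧
      (2 : ℤ) • ∑ s ∈ indices₂ w i j, M s =
        coeffN w d ((i : ℕ) + 1) ((j : ℕ) + 1) • beta w := by
  have hi := i.2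
  rcases hij.eq_or_lt with rfl | hlt
  · rw [indices₂_self_eq_filter, sum_M_eq_mk w _ (fun j => by split_ifs <;> omega),
      sum_MStar_eq_mk w _ (fun j => by split_ifs <;> omega), zsmul_beta_eq_mk, ← map_zsmul,
      ← map_zsmul]
    refine ⟨mk_eq_mk_of_forall_lt (w + 2) fun p hp => ?_,
      mk_eq_mk_of_forall_lt (w + 2) fun p hp => ?_⟩
    · rw [Pi.smul_apply, ofFn_geomTail_ite, ofFn_ite_eq,
        coeff_chainSum_three_eq_star hp hodd _ _ (by omega) hdw]
      simp
    · rw [Pi.smul_apply, ofFn_geomTail_ite, ofFn_ite_eq, zsmul_eq_mul, Int.cast_ofNat,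
        two_mul_coeff_chainSum_three hp hodd _ _ (by omega) hdw, coeffN,
        show d + 1 - ((j : ℕ) + 1) = d - ((j : ℕ) + 1) + 1 by omega]
  · have hlt' : (j : ℕ) < i := hlt
    rw [indices₂_eq_filter w hlt, sum_M_eq_mk w _ (fun j => by split_ifs <;> omega),
      sum_MStar_eq_mk w _ (fun j => by split_ifs <;> omega), zsmul_beta_eq_mk, ← map_zsmul,
      ← map_zsmul]
    refine ⟨mk_eq_mk_of_forall_lt (w + 2) fun p hp => ?_,
      mk_eq_mk_of_forall_lt (w + 2) fun p hp => ?_⟩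
    · rw [Pi.smul_apply, ofFn_geomTail_ite, ofFn_ite_or_eq _ _ hlt,
        coeff_chainSum_two_two_eq_star hp hodd _ _ _ (by omega) hdw]
      simp
    · rw [Pi.smul_apply, ofFn_geomTail_ite, ofFn_ite_or_eq _ _ hlt, zsmul_eq_mul, Int.cast_ofNat,
        two_mul_coeff_chainSum_two_two hp hodd _ _ _ (by omega) hdw, coeffN,
        show d + 1 - ((i : ℕ) + 1) = d - ((i : ℕ) + 1) + 1 by omega]

end FiniteMMV


/-- `Fin d` is zero-based: the entry `s i` with `i : Fin d` is the entry `s_{i+1}` in one-based numbering. -/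
theorem mainTheorem4 (w d : ℕ) (hd : 1 ≤ d) (hdw : d ≤ w) :
    (∑ s ∈ FiniteMMV.indices w d, FiniteMMV.M s = 0 ∧
      ∑ s ∈ FiniteMMV.indices w d, FiniteMMV.MStar s = 0) ∧
    (∀ i : Fin d,
      ∑ s ∈ FiniteMMV.indices₁ w i, FiniteMMV.M s =
        ((-1 : ℤ) ^ (i : ℕ) * (((w - 1).choose (i : ℕ) : ℤ) +
          (-1) ^ d * ((w - 1).choose (d - ((i : ℕ) + 1)) : ℤ))) • FiniteMMV.beta w ∧
      ∑ s ∈ FiniteMMV.indices₁ w i, FiniteMMV.MStar s =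
        ((-1 : ℤ) ^ (i : ℕ) * ((-1) ^ d * ((w - 1).choose (i : ℕ) : ℤ) +
          ((w - 1).choose (d - ((i : ℕ) + 1)) : ℤ))) • FiniteMMV.beta w) ∧
    (Odd w → ∀ i j : Fin d, j ≤ i →
      ∑ s ∈ FiniteMMV.indices₂ w i j, FiniteMMV.M s =
        (-1 : ℤ) ^ d • ∑ s ∈ FiniteMMV.indices₂ w i j, FiniteMMV.MStar s ∧
      ∑ s ∈ FiniteMMV.indices₂ w i j, FiniteMMV.M s =
        ((1 / 2 : ℚ) * (FiniteMMV.coeffN w d ((i : ℕ) + 1) ((j : ℕ) + 1) : ℚ)) •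
          FiniteMMV.beta w) := by
  refine ⟨FiniteMMV.sum_indices_eq_zero hd, fun i => ⟨FiniteMMV.sum_indices₁_M hdw i,
    FiniteMMV.sum_indices₁_MStar hdw i⟩, fun hodd i j hij => ?_⟩
  obtain ⟨h1, h2⟩ := FiniteMMV.sum_indices₂ hdw hodd hij
  refine ⟨h1, ?_⟩
  rw [mul_smul, Int.cast_smul_eq_zsmul, ← h2, ← Int.cast_smul_eq_zsmul ℚ, ← mul_smul]
  norm_num
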